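/- **Setting.** Let $(\Omega,\mathcal F,\mathbb P)$ be a probability space with a filtration $\mathbb F=(\mathcal F_n)_{n\ge 0}$, let $\Delta\ge 1$ be an integer, $\mathbb U$ a finite nonempty subset of $\mathbb R^d$, $\theta>0$, and let $(X_n)_{n\ge 0}$ be an $\mathbb F$-adapted $\mathbb R^d$-valued process. Let $g:\mathbb R^d\to\mathbb R$ be bounded and Borel measurable and $\Psi:\mathbb R^d\to\mathbb R$ any function, and put $\|g\|_\infty=\sup_x|g(x)|$, $\|\Psi\|_\infty=\sup_{u\in\mathbb U}|\Psi(u)|$. The set $\mathcal A$ of admissible strategies consists of the sequences $\delta=(\tau_p,\xi_p)_{p\ge 0}$ where each $\tau_p$ is an $\mathbb F$-stopping time with values in $\mathbb N\cup\{\infty\}$, $\tau_{p+1}\ge\tau_p+\Delta$ $\mathbb P$-a.s., and $\xi_p$ is a $\mathbb U$-valued $\mathcal F_{\tau_p}$-measurable random variable; $\mathcal A_n$ is the set of $\delta\in\mathcal A$ with $\tau_n=\infty$ $\mathbb P$-a.s. (at most $n$ impulses). For $\delta\in\mathcal A$ set $$X^\delta_k=X_k1_{\{k<\tau_0+\Delta\}}+\sum_{\ell\ge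 0}(X_k+\xi_0+\dots+\xi_\ell)1_{\{\tau_\ell+\Delta\le k<\tau_{\ell+1}+\Delta\}},$$ $$J(\delta)=\mathbb E\Big[\sum_{k\ge 0}e^{-\theta k}g(X^\delta_k)-\sum_{\ell\ge 0}e^{-\theta(\tau_\ell+\Delta)}\Psi(\xi_\ell)\Big],\qquad e^{-\theta\cdot\infty}:=0 .$$ **Proposition (bounded $\varepsilon$-optimal strategies).** For every $\delta\in\mathcal A$ the random variable inside the expectation defining $J(\delta)$ is integrable. Let $\varepsilon>0$. Then there exist a deterministic integer $n_\varepsilon\ge 1$ and a strategy $\delta_\varepsilon\in\mathcal A_{n_\varepsilon}$ such that $$\sup_{\delta\in\mathcal A}J(\delta)\le J(\delta_\varepsilon)+\varepsilon .$$ More precisely, for every integer $n_\varepsilon\ge 1$ with $$n_\varepsilon\ \ge\ \Big\lfloor\frac1{\theta\Delta}\ln\frac{C_0}{\varepsilon}\Big\rfloor+1,\qquad C_0:=e^{-\theta\Delta}\Big(\frac{2\|g\|_\infty}{1-e^{-\theta}}+\frac{\|\Psi\|_\infty}{1-e^{-\theta\Delta}}\Big)$$ (when $C_0=0$ every $n_\varepsilon\ge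 1$ is allowed), there is an optimal strategy $\delta_\varepsilon$ in $\mathcal A_{n_\varepsilon}$, that is, $\delta_\varepsilon\in\mathcal A_{n_\varepsilon}$ and $J(\delta_\varepsilon)=\sup_{\delta\in\mathcal A_{n_\varepsilon}}J(\delta)$, and it satisfies $\sup_{\delta\in\mathcal A}J(\delta)\le J(\delta_\varepsilon)+\varepsilon$. -/

import Mathlib

open MeasureTheory

namespace ImpulseControl

/-- A pair of sequences `(τ_p, ξ_p)_{p ≥ 0}`: decision times in `ℕ ∪ {∞}` and impulse sizes
in `ℝ^d`. -/
structure Strategy (Ω : Type*) (d : ℕ) where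
  τ : ℕ → Ω → WithTop ℕ
  ξ : ℕ → Ω → EuclideanSpace ℝ (Fin d)

/-- The set `𝒜` of admissible strategies with delay `Δ` and impulses in `U`. The gap condition
`τ_{p+1} - τ_p ≥ Δ` is written additively, so that `τ_p = ∞` forces `τ_{p+1} = ∞`.
`hτ.measurableSpace` consists of the `A` in `ℱ_∞ = σ(ℱ_n, n ≥ 0)` with
`A ∩ {τ_p ≤ n} ∈ ℱ_n` for all `n`. -/
def admissible {Ω : Type*} {m : MeasurableSpace Ω} {d : ℕ} (P : Measure Ω)
    (ℱ : Filtration ℕ m) (Δ : ℕ) (U : Finset (EuclideanSpace ℝ (Fin d))) :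
    Set (Strategy Ω d) :=
  {δ | ∀ p : ℕ,
      (∃ hτ : IsStoppingTime ℱ (δ.τ p), Measurable[hτ.measurableSpace] (δ.ξ p)) ∧
      (∀ ω, δ.ξ p ω ∈ U) ∧
      (∀ᵐ ω ∂P, δ.τ p ω + (Δ : WithTop ℕ) ≤ δ.τ (p + 1) ω)}

/-- The set `𝒜_n` of admissible strategies with `τ_n = ∞` almost surely, that is, with at most
`n` impulses. -/
def admissibleAtMost {Ω : Type*} {m : MeasurableSpace Ω} {d : ℕ} (P : Measure Ω)
    (ℱ : Filtration ℕ m) (Δ : ℕ) (U : Finset (EuclideanSpace ℝ (Fin d))) (n : ℕ) :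
    Set (Strategy Ω d) :=
  {δ | δ ∈ admissible P ℱ Δ U ∧ ∀ᵐ ω ∂P, δ.τ n ω = ⊤}

/-- The controlled process
`X^δ_k = X_k 1_{k < τ_0 + Δ} + ∑_ℓ (X_k + ξ_0 + ⋯ + ξ_ℓ) 1_{τ_ℓ + Δ ≤ k < τ_{ℓ+1} + Δ}`. -/
noncomputable def controlled {Ω : Type*} {d : ℕ} (Δ : ℕ)
    (X : ℕ → Ω → EuclideanSpace ℝ (Fin d)) (δ : Strategy Ω d) (k : ℕ) (ω : Ω) :
    EuclideanSpace ℝ (Fin d) :=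
  (if (k : WithTop ℕ) < δ.τ 0 ω + (Δ : WithTop ℕ) then X k ω else 0) +
    ∑' l : ℕ,
      if δ.τ l ω + (Δ : WithTop ℕ) ≤ (k : WithTop ℕ) ∧
          (k : WithTop ℕ) < δ.τ (l + 1) ω + (Δ : WithTop ℕ)
      then X k ω + ∑ i ∈ Finset.range (l + 1), δ.ξ i ω else 0

/-- The discount factor `e^{-θ t}` for `t ∈ ℕ ∪ {∞}`, with `e^{-θ ∞} = 0`. -/
noncomputable def discount (θ : ℝ) : WithTop ℕ → ℝ
  | ⊤ => 0
  | (k : ℕ) => Real.exp (-θ * (k : ℝ))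

/-- The random total payoff
`∑_{k ≥ 0} e^{-θ k} g(X^δ_k) - ∑_{ℓ ≥ 0} e^{-θ (τ_ℓ + Δ)} Ψ(ξ_ℓ)`. -/
noncomputable def totalPayoff {Ω : Type*} {d : ℕ} (Δ : ℕ) (θ : ℝ)
    (g Ψ : EuclideanSpace ℝ (Fin d) → ℝ)
    (X : ℕ → Ω → EuclideanSpace ℝ (Fin d)) (δ : Strategy Ω d) (ω : Ω) : ℝ :=
  (∑' k : ℕ, Real.exp (-θ * (k : ℝ)) * g (controlled Δ X δ k ω)) -
    ∑' l : ℕ, discount θ (δ.τ l ω + (Δ : WithTop ℕ)) * Ψ (δ.ξ l ω)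

/-- The risk-neutral utility `J(δ)`. -/
noncomputable def J {Ω : Type*} {m : MeasurableSpace Ω} {d : ℕ} (P : Measure Ω) (Δ : ℕ) (θ : ℝ)
    (g Ψ : EuclideanSpace ℝ (Fin d) → ℝ)
    (X : ℕ → Ω → EuclideanSpace ℝ (Fin d)) (δ : Strategy Ω d) : ℝ :=
  ∫ ω, totalPayoff Δ θ g Ψ X δ ω ∂P

/-- The constant
`C₀ = e^{-θΔ} (2 ‖g‖_∞ / (1 - e^{-θ}) + ‖Ψ‖_∞ / (1 - e^{-θΔ}))`, where
`‖g‖_∞ = sup_x |g x|` and `‖Ψ‖_∞ = sup_{u ∈ U} |Ψ u|`. -/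
noncomputable def tailConst {d : ℕ} (Δ : ℕ) (θ : ℝ) (U : Finset (EuclideanSpace ℝ (Fin d)))
    (g Ψ : EuclideanSpace ℝ (Fin d) → ℝ) : ℝ :=
  Real.exp (-θ * (Δ : ℝ)) *
    (2 * (⨆ x, |g x|) / (1 - Real.exp (-θ)) +
      (⨆ u : {u // u ∈ U}, |Ψ u|) / (1 - Real.exp (-θ * (Δ : ℝ))))

end ImpulseControl

/-! Decision times are at least `Δ` apart, so almost surely `τ_p ≥ pΔ`, and the impulse of index `n`
takes effect no earlier than `(n+1)Δ`. Discarding all impulses of index at least `n` therefore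
affects only the running rewards from time `(n+1)Δ` on and the costs of index at least `n`. These
two geometric tails add up to `C₀ e^{-θΔn}` (`Strategy.HasGaps.abs_totalPayoff_sub_truncate_le`),
which the threshold on `n` makes at most `ε`. Hence a strategy that is optimal in `𝒜_n` is
`ε`-optimal in `𝒜`.

It remains to see that the supremum over `𝒜_n` is attained. A strategy is recoded as an adapted
process with values in the finite set `Option U`: at each time, order one impulse or none. The gap
condition and the bound `n` become a constraint on the next action given the past ones, and the
payoff becomes a sum of discounted rewards, each depending on the past actions and on `ω`
(`Strategy.HasGaps.totalPayoff_eq`).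

No Markov property is available, so the value is a random variable indexed by the list of past
actions. Value iteration with conditional expectations converges geometrically to a solution of the
Bellman equation (`value_eq_sup'`). Since only finitely many actions compete, a maximizer can be
chosen measurably, and telescoping expectations shows that following it is optimal
(`exists_optimal_actions`). The maps `Strategy.actions` and `strategyOfActions` carry this result
back to strategies. -/

namespace ImpulseControl

/-! ### Value iteration and the Bellman equation for history-dependent problems. -/

section DynamicProgramming

open Filter Topology

/-- Together with the same property of conditional expectation, this makes the Bellman operator
nonexpansive. -/
theorem abs_sup'_sub_sup'_le {ι : Type*} {s : Finset ι} (hs : s.Nonempty) {f g : ι → ℝ} {c : ℝ}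
    (h : ∀ x ∈ s, |f x - g x| ≤ c) : |s.sup' hs f - s.sup' hs g| ≤ c := by
  rw [abs_sub_le_iff]
  constructor
  · rw [sub_le_iff_le_add]
    refine Finset.sup'_le _ _ fun x hx => ?_
    have h1 := (abs_le.1 (h x hx)).2
    have h2 := Finset.le_sup' g hx
    linarith
  · rw [sub_le_iff_le_add]
    refine Finset.sup'_le _ _ fun x hx => ?_
    have h1 := (abs_le.1 (h x hx)).1
    have h2 := Finset.le_sup' f hx
    linarith

theorem abs_sup'_le {ι : Type*} {s : Finset ι} (hs : s.Nonempty) {f : ι → ℝ} {c : ℝ}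
    (h : ∀ x ∈ s, |f x| ≤ c) : |s.sup' hs f| ≤ c := by
  simpa using abs_sup'_sub_sup'_le hs (f := f) (g := fun _ => (0 : ℝ)) (by simpa using h)

theorem measurable_sup'_apply {Ω A : Type*} {m : MeasurableSpace Ω} {s : Finset A}
    (hs : s.Nonempty) {f : A → Ω → ℝ} (hf : ∀ x, Measurable (f x)) :
    Measurable fun ω => s.sup' hs (fun x => f x ω) := by
  have := Finset.measurable_sup' hs (f := f) fun x _ => hf x
  convert this using 1
  ext ω
  simp

/-- A pointwise maximizer of finitely many measurable functions can be selected measurably. -/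
theorem exists_measurable_argmax {Ω A : Type*} {m : MeasurableSpace Ω} {s : Finset A}
    (hs : s.Nonempty) {f : A → Ω → ℝ} (hf : ∀ x, Measurable (f x)) :
    ∃ b : Ω → A, (∀ x, MeasurableSet {ω | b ω = x}) ∧ (∀ ω, b ω ∈ s) ∧
      ∀ ω, s.sup' hs (fun x => f x ω) = f (b ω) ω := by
  classical
  induction hs using Finset.Nonempty.cons_induction with
  | singleton y =>
    exact ⟨fun _ => y, fun x => MeasurableSet.const _, by simp, by simp⟩
  | cons y s hy hs ih =>
    obtain ⟨b, hb, hbs, hbf⟩ := ih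
    have hsup := measurable_sup'_apply hs hf
    have hlt : MeasurableSet {ω | s.sup' hs (fun x => f x ω) ≤ f y ω} :=
      measurableSet_le hsup (hf y)
    -- The new element wins ties against the maximizer already selected among the others, so only
    -- one measurable comparison is added.
    refine ⟨fun ω => if s.sup' hs (fun x => f x ω) ≤ f y ω then y else b ω, fun x => ?_,
      fun ω => ?_, fun ω => ?_⟩
    · have : {ω | (if s.sup' hs (fun x => f x ω) ≤ f y ω then y else b ω) = x} =
          ({ω | s.sup' hs (fun x => f x ω) ≤ f y ω} ∩ {_ω | y = x}) ∪
          ({ω | s.sup' hs (fun x => f x ω) ≤ f y ω}ᶜ ∩ {ω | b ω = x}) := by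
        ext ω
        by_cases h : s.sup' hs (fun x => f x ω) ≤ f y ω <;>
          simp only [Set.mem_ofPred_eq, Set.mem_union, Set.mem_inter_iff, Set.mem_compl_iff, h,
            if_true, if_false] <;> simp
      rw [this]
      exact (hlt.inter (MeasurableSet.const _)).union (hlt.compl.inter (hb x))
    · dsimp only
      split_ifs
      · simp
      · simp [hbs ω]
    · dsimp only
      rw [Finset.sup'_cons hs]
      split_ifs with h
      · exact max_eq_left h
      · rw [← hbf ω]
        exact max_eq_right (not_le.1 h).le

theorem measurable_apply_of_countable {Ω β : Type*} {m : MeasurableSpace Ω} [Countable β]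
    {H : Ω → β} (hH : ∀ b, MeasurableSet {ω | H ω = b}) {f : β → Ω → ℝ}
    (hf : ∀ b, Measurable (f b)) : Measurable fun ω => f (H ω) ω := by
  intro s hs
  have : (fun ω => f (H ω) ω) ⁻¹' s = ⋃ b, {ω | H ω = b} ∩ f b ⁻¹' s := by
    ext ω; simp
  rw [this]
  exact MeasurableSet.iUnion fun b => (hH b).inter (hf b hs)

/-- A tower property for a random index: each `f b` is conditioned with `b` frozen, and `b = H ω` is
inserted afterwards. As `H` is `m`-measurable with countably many values, it suffices to integrate
over each event `H = b`. -/
theorem integral_condExp_apply {Ω β : Type*} {m m0 : MeasurableSpace Ω} [Countable β]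
    {P : Measure Ω} [IsFiniteMeasure P] (hm : m ≤ m0)
    {H : Ω → β} (hH : ∀ b, MeasurableSet[m] {ω | H ω = b}) {f : β → Ω → ℝ} {C : ℝ}
    (hf : ∀ b, Measurable[m0] (f b)) (hC : ∀ b, ∀ᵐ ω ∂P, |f b ω| ≤ C) :
    ∫ ω, (P[f (H ω) | m]) ω ∂P = ∫ ω, f (H ω) ω ∂P := by
  have hH0 : ∀ b, MeasurableSet[m0] {ω | H ω = b} := fun b => hm _ (hH b)
  have hU : ⋃ b, {ω | H ω = b} = Set.univ := by ext ω; simp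
  have hd : Pairwise (Function.onFun Disjoint fun b => {ω | H ω = b}) := by
    intro b c hbc
    refine Set.disjoint_left.2 fun ω h1 h2 => hbc ?_
    simp only [Set.mem_ofPred_eq] at h1 h2
    rw [← h1, ← h2]
  have hfi : ∀ b, Integrable (f b) P := fun b =>
    Integrable.of_bound (hf b).aestronglyMeasurable C (hC b)
  have i1 : Integrable (fun ω => f (H ω) ω) P := by
    refine Integrable.of_bound (measurable_apply_of_countable hH0 hf).aestronglyMeasurable C ?_
    filter_upwards [ae_all_iff.2 hC] with ω hω using hω _
  have i2 : Integrable (fun ω => (P[f (H ω) | m]) ω) P := by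
    refine Integrable.of_bound (measurable_apply_of_countable (f := fun b => P[f b | m]) hH0
      fun b => (stronglyMeasurable_condExp.mono hm).measurable).aestronglyMeasurable C ?_
    filter_upwards [ae_all_iff.2 fun b => ae_bdd_abs_condExp_of_ae_bdd_abs (m := m) (hC b)]
      with ω hω using hω _
  rw [← setIntegral_univ, ← setIntegral_univ (f := fun ω => f (H ω) ω), ← hU,
    integral_iUnion hH0 hd i2.integrableOn, integral_iUnion hH0 hd i1.integrableOn]
  refine tsum_congr fun b => ?_
  calc ∫ ω in {ω | H ω = b}, (P[f (H ω) | m]) ω ∂P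
      = ∫ ω in {ω | H ω = b}, (P[f b | m]) ω ∂P :=
        setIntegral_congr_fun (hH0 b) fun ω hω => by
          simp only [Set.mem_ofPred_eq] at hω; simp only [hω]
    _ = ∫ ω in {ω | H ω = b}, f b ω ∂P := setIntegral_condExp hm (hfi b) (hH b)
    _ = ∫ ω in {ω | H ω = b}, f (H ω) ω ∂P :=
        setIntegral_congr_fun (hH0 b) fun ω hω => by
          simp only [Set.mem_ofPred_eq] at hω; simp only [hω]

theorem abs_condExp_sub_condExp_le {Ω : Type*} {m m0 : MeasurableSpace Ω} {P : Measure Ω}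
    {f g : Ω → ℝ} (hf : Integrable f P) (hg : Integrable g P) {c : ℝ}
    (h : ∀ᵐ ω ∂P, |f ω - g ω| ≤ c) : ∀ᵐ ω ∂P, |(P[f | m]) ω - (P[g | m]) ω| ≤ c := by
  have h1 := ae_bdd_abs_condExp_of_ae_bdd_abs (m := m) (f := f - g) h
  filter_upwards [h1, condExp_sub hf hg m] with ω h1 h2
  rw [h2] at h1
  exact h1

variable {Ω A : Type*}

/-- The actions chosen before time `t`, the most recent one first. -/
def history (a : ℕ → Ω → A) : ℕ → Ω → List A
  | 0, _ => []
  | t + 1, ω => a t ω :: history a t ω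

@[simp] theorem length_history (a : ℕ → Ω → A) (t : ℕ) (ω : Ω) : (history a t ω).length = t := by
  induction t with
  | zero => rfl
  | succ t ih => simp [history, ih]

variable {m : MeasurableSpace Ω}

/-- Adaptedness of a process with values in a countable set without σ-algebra. -/
def AdaptedActions (ℱ : Filtration ℕ m) (a : ℕ → Ω → A) : Prop :=
  ∀ t x, MeasurableSet[ℱ t] {ω | a t ω = x}

theorem measurableSet_history_succ {a : ℕ → Ω → A} {t : ℕ}
    (ha : ∀ x, MeasurableSet {ω | a t ω = x}) (ht : ∀ h, MeasurableSet {ω | history a t ω = h})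
    (h : List A) : MeasurableSet {ω | history a (t + 1) ω = h} := by
  cases h with
  | nil => simp [history]
  | cons x h =>
    have : {ω | history a (t + 1) ω = x :: h} = {ω | a t ω = x} ∩ {ω | history a t ω = h} := by
      ext ω; simp [history]
    rw [this]
    exact (ha x).inter (ht h)

theorem AdaptedActions.measurableSet_history_succ {ℱ : Filtration ℕ m} {a : ℕ → Ω → A}
    (ha : AdaptedActions ℱ a) (t : ℕ) :
    ∀ h, MeasurableSet[ℱ t] {ω | history a (t + 1) ω = h} := by
  refine ImpulseControl.measurableSet_history_succ (m := ℱ t) (ha t) ?_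
  induction t with
  | zero => intro h; simp only [history]; exact MeasurableSet.const _
  | succ t ih =>
    exact fun h => ℱ.mono t.le_succ _
      (ImpulseControl.measurableSet_history_succ (m := ℱ t) (ha t) ih h)

theorem AdaptedActions.measurableSet_history {ℱ : Filtration ℕ m} {a : ℕ → Ω → A}
    (ha : AdaptedActions ℱ a) (t : ℕ) (h : List A) :
    MeasurableSet[ℱ t] {ω | history a t ω = h} := by
  cases t with
  | zero => simp only [history]; exact MeasurableSet.const _
  | succ t => exact ℱ.mono t.le_succ _ (ha.measurableSet_history_succ t h)

/-- Value iteration: the optimal reward over the next `n` periods, given the past actions `h`,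
when the actions allowed after `h` are `S h` and `r (x :: h)` is the reward of `x` after `h`. -/
noncomputable def valueIter (P : Measure Ω) (ℱ : Filtration ℕ m) (S : List A → Finset A)
    (hS : ∀ h, (S h).Nonempty) (r : List A → Ω → ℝ) : ℕ → List A → Ω → ℝ
  | 0, _ => 0
  | n + 1, h => fun ω => (S h).sup' (hS h) fun x =>
      (P[r (x :: h) + valueIter P ℱ S hS r n (x :: h) | ℱ h.length]) ω

/-- The optimal future reward given the past actions. -/
noncomputable def value (P : Measure Ω) (ℱ : Filtration ℕ m) (S : List A → Finset A)
    (hS : ∀ h, (S h).Nonempty) (r : List A → Ω → ℝ) (h : List A) (ω : Ω) : ℝ :=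
  limsup (fun n => valueIter P ℱ S hS r n h ω) atTop

section

variable {P : Measure Ω} {ℱ : Filtration ℕ m} {S : List A → Finset A}
  {hS : ∀ h, (S h).Nonempty} {r : List A → Ω → ℝ}

theorem measurable_sup'_condExp (f : A → Ω → ℝ) (h : List A) :
    Measurable[ℱ h.length] fun ω =>
      (S h).sup' (hS h) fun x => (P[f x | ℱ h.length]) ω := by
  exact measurable_sup'_apply (m := ℱ h.length) (hS h) fun x =>
    stronglyMeasurable_condExp.measurable

theorem measurable_valueIter (n : ℕ) (h : List A) :
    Measurable[ℱ h.length] (valueIter P ℱ S hS r n h) := by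
  cases n with
  | zero => exact measurable_const
  | succ n => exact measurable_sup'_condExp (hS := hS) _ h

theorem measurable_value (h : List A) : Measurable[ℱ h.length] (value P ℱ S hS r h) :=
  Measurable.limsup fun n => measurable_valueIter n h

variable [IsFiniteMeasure P] {K q : ℝ} (hq0 : 0 ≤ q) (hq1 : q < 1)
  (hr : ∀ h, Measurable (r h)) (hK : ∀ x h ω, |r (x :: h) ω| ≤ K * q ^ h.length)

include hq1 in
theorem bound_step (t : ℕ) : K * q ^ t + K * q ^ (t + 1) / (1 - q) = K * q ^ t / (1 - q) := by
  have : 1 - q ≠ 0 := by linarith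
  field_simp
  ring

omit [IsFiniteMeasure P] in
include hq1 hK in
theorem abs_valueIter_le (n : ℕ) (h : List A) :
    ∀ᵐ ω ∂P, |valueIter P ℱ S hS r n h ω| ≤ K * q ^ h.length / (1 - q) := by
  -- Nonnegativity of `K * q ^ h.length` is read off from `hK` at some point of `Ω`, so the empty
  -- space is set apart.
  rcases isEmpty_or_nonempty Ω with hΩ | ⟨⟨ω0⟩⟩
  · exact ae_of_all _ fun ω => isEmptyElim ω
  have h0 : ∀ h : List A, 0 ≤ K * q ^ h.length / (1 - q) := by
    intro h
    obtain ⟨x, -⟩ := hS h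
    exact div_nonneg ((abs_nonneg _).trans (hK x h ω0)) (by linarith)
  induction n generalizing h with
  | zero => exact ae_of_all _ fun ω => by simpa [valueIter] using h0 h
  | succ n ih =>
    have key : ∀ x ∈ S h, ∀ᵐ ω ∂P,
        |(P[r (x :: h) + valueIter P ℱ S hS r n (x :: h) | ℱ h.length]) ω| ≤
          K * q ^ h.length / (1 - q) := by
      intro x _
      refine ae_bdd_abs_condExp_of_ae_bdd_abs ?_
      filter_upwards [ih (x :: h)] with ω hω
      rw [← bound_step hq1]
      exact (abs_add_le _ _).trans (add_le_add (hK x h ω) (by simpa using hω))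
    filter_upwards [(ae_ball_iff (S h).countable_toSet).2 key] with ω hω
    exact abs_sup'_le (hS h) hω

include hq1 hr hK in
theorem integrable_reward_add_valueIter (n : ℕ) (x : A) (h : List A) :
    Integrable (r (x :: h) + valueIter P ℱ S hS r n (x :: h)) P := by
  refine Integrable.add ?_ ?_
  · exact Integrable.of_bound (hr _).aestronglyMeasurable _ (ae_of_all _ (hK x h))
  · exact Integrable.of_bound ((measurable_valueIter n _).mono (ℱ.le _) le_rfl).aestronglyMeasurable
      _ (abs_valueIter_le hq1 hK n _)

-- Maximum and conditional expectation do not increase sup distances, and each recursive step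
-- lengthens the history by one, which gains a factor `q`.
include hq1 hr hK in
theorem abs_valueIter_succ_sub_le (n : ℕ) (h : List A) :
    ∀ᵐ ω ∂P, |valueIter P ℱ S hS r (n + 1) h ω - valueIter P ℱ S hS r n h ω| ≤
      K * q ^ h.length * q ^ n := by
  induction n generalizing h with
  | zero =>
    have key : ∀ x ∈ S h, ∀ᵐ ω ∂P,
        |(P[r (x :: h) + valueIter P ℱ S hS r 0 (x :: h) | ℱ h.length]) ω| ≤
          K * q ^ h.length := by
      intro x _
      refine ae_bdd_abs_condExp_of_ae_bdd_abs (ae_of_all _ fun ω => ?_)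
      simpa [valueIter] using hK x h ω
    filter_upwards [(ae_ball_iff (S h).countable_toSet).2 key] with ω hω
    have := abs_sup'_le (hS h) hω
    simpa [valueIter] using this
  | succ n ih =>
    have key : ∀ x ∈ S h, ∀ᵐ ω ∂P,
        |(P[r (x :: h) + valueIter P ℱ S hS r (n + 1) (x :: h) | ℱ h.length]) ω -
          (P[r (x :: h) + valueIter P ℱ S hS r n (x :: h) | ℱ h.length]) ω| ≤
          K * q ^ h.length * q ^ (n + 1) := by
      intro x _
      refine abs_condExp_sub_condExp_le (integrable_reward_add_valueIter hq1 hr hK _ _ _)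
        (integrable_reward_add_valueIter hq1 hr hK _ _ _) ?_
      filter_upwards [ih (x :: h)] with ω hω
      simp only [Pi.add_apply, add_sub_add_left_eq_sub]
      refine hω.trans (le_of_eq ?_)
      simp only [List.length_cons]
      ring
    filter_upwards [(ae_ball_iff (S h).countable_toSet).2 key] with ω hω
    exact abs_sup'_sub_sup'_le (hS h) hω

include hq1 hr hK in
theorem abs_value_sub_valueIter_le (h : List A) :
    ∀ᵐ ω ∂P, ∀ n, |value P ℱ S hS r h ω - valueIter P ℱ S hS r n h ω| ≤
      K * q ^ h.length * q ^ n / (1 - q) := by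
  filter_upwards [ae_all_iff.2 fun n => abs_valueIter_succ_sub_le (ℱ := ℱ) (hS := hS) (P := P)
    hq1 hr hK n h] with ω hω n
  have hu : ∀ n, dist (valueIter P ℱ S hS r n h ω) (valueIter P ℱ S hS r (n + 1) h ω) ≤
      K * q ^ h.length * q ^ n := fun n => by
    rw [dist_comm, Real.dist_eq]; exact hω n
  obtain ⟨l, hl⟩ := cauchySeq_tendsto_of_complete (cauchySeq_of_le_geometric q _ hq1 hu)
  have hv : value P ℱ S hS r h ω = l := hl.limsup_eq
  have := dist_le_of_le_geometric_of_tendsto q _ hq1 hu hl n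
  rwa [dist_comm, Real.dist_eq, ← hv] at this

include hq1 hr hK in
theorem abs_value_le (h : List A) :
    ∀ᵐ ω ∂P, |value P ℱ S hS r h ω| ≤ K * q ^ h.length / (1 - q) := by
  filter_upwards [abs_value_sub_valueIter_le (ℱ := ℱ) (hS := hS) (P := P) hq1 hr hK h] with ω hω
  simpa [valueIter] using hω 0

include hq1 hr hK in
theorem abs_reward_add_value_le (x : A) (h : List A) :
    ∀ᵐ ω ∂P, |(r (x :: h) + value P ℱ S hS r (x :: h)) ω| ≤ K * q ^ h.length / (1 - q) := by
  filter_upwards [abs_value_le (ℱ := ℱ) (hS := hS) (P := P) hq1 hr hK (x :: h)] with ω hω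
  rw [← bound_step hq1]
  exact (abs_add_le _ _).trans (add_le_add (hK x h ω) (by simpa using hω))

omit [IsFiniteMeasure P] in
include hr in
theorem measurable_reward_add_value (h : List A) :
    Measurable (r h + value P ℱ S hS r h) :=
  (hr h).add ((measurable_value h).mono (ℱ.le _) le_rfl)

include hq0 hq1 hr hK in
/-- The Bellman equation. -/
theorem value_eq_sup' (h : List A) :
    ∀ᵐ ω ∂P, value P ℱ S hS r h ω = (S h).sup' (hS h) fun x =>
      (P[r (x :: h) + value P ℱ S hS r (x :: h) | ℱ h.length]) ω := by
  have key : ∀ n, ∀ᵐ ω ∂P, |((S h).sup' (hS h) fun x =>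
      (P[r (x :: h) + value P ℱ S hS r (x :: h) | ℱ h.length]) ω) -
      valueIter P ℱ S hS r (n + 1) h ω| ≤ K * q ^ h.length * q ^ (n + 1) / (1 - q) := by
    intro n
    have key : ∀ x ∈ S h, ∀ᵐ ω ∂P,
        |(P[r (x :: h) + value P ℱ S hS r (x :: h) | ℱ h.length]) ω -
          (P[r (x :: h) + valueIter P ℱ S hS r n (x :: h) | ℱ h.length]) ω| ≤
          K * q ^ h.length * q ^ (n + 1) / (1 - q) := by
      intro x _
      refine abs_condExp_sub_condExp_le
        (Integrable.of_bound (measurable_reward_add_value hr _).aestronglyMeasurable _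
          (abs_reward_add_value_le hq1 hr hK x h))
        (integrable_reward_add_valueIter hq1 hr hK _ _ _) ?_
      filter_upwards [abs_value_sub_valueIter_le (ℱ := ℱ) (hS := hS) (P := P) hq1 hr hK (x :: h)]
        with ω hω
      simp only [Pi.add_apply, add_sub_add_left_eq_sub]
      refine (hω n).trans (le_of_eq ?_)
      simp only [List.length_cons]
      ring
    filter_upwards [(ae_ball_iff (S h).countable_toSet).2 key] with ω hω
    exact abs_sup'_sub_sup'_le (hS h) hω
  filter_upwards [ae_all_iff.2 key,
    abs_value_sub_valueIter_le (ℱ := ℱ) (hS := hS) (P := P) hq1 hr hK h] with ω h1 h2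
  -- Both sides of the Bellman equation are limits of the same sequence `valueIter (n + 1)`, with
  -- this error bound.
  have hlim : Tendsto (fun n : ℕ => K * q ^ h.length * q ^ (n + 1) / (1 - q)) atTop (𝓝 0) := by
    have := ((tendsto_pow_atTop_nhds_zero_of_lt_one hq0 hq1).comp (tendsto_add_atTop_nat 1)
      |>.const_mul (K * q ^ h.length)).div_const (1 - q)
    simpa using this
  have t1 : Tendsto (fun n => valueIter P ℱ S hS r (n + 1) h ω) atTop
      (𝓝 (value P ℱ S hS r h ω)) :=
    tendsto_iff_dist_tendsto_zero.2 (squeeze_zero (fun _ => dist_nonneg) (fun n => by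
      rw [dist_comm, Real.dist_eq]; exact h2 (n + 1)) hlim)
  have t2 : Tendsto (fun n => valueIter P ℱ S hS r (n + 1) h ω) atTop
      (𝓝 ((S h).sup' (hS h) fun x =>
        (P[r (x :: h) + value P ℱ S hS r (x :: h) | ℱ h.length]) ω)) :=
    tendsto_iff_dist_tendsto_zero.2 (squeeze_zero (fun _ => dist_nonneg) (fun n => by
      rw [dist_comm, Real.dist_eq]; exact h1 n) hlim)
  exact tendsto_nhds_unique t1 t2

end

end DynamicProgramming

/-! ### Verification: adapted actions compared with the value. -/

section Verification

open Filter Topology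

variable {Ω A : Type*} {m : MeasurableSpace Ω} {P : Measure Ω} {ℱ : Filtration ℕ m}
  {S : List A → Finset A} {hS : ∀ h, (S h).Nonempty} {r : List A → Ω → ℝ}
  [IsFiniteMeasure P] [Countable A] {K q : ℝ} (hq0 : 0 ≤ q) (hq1 : q < 1)
  (hr : ∀ h, Measurable (r h)) (hK : ∀ x h ω, |r (x :: h) ω| ≤ K * q ^ h.length)
  {b : ℕ → Ω → A} (hb : AdaptedActions ℱ b)

omit [IsFiniteMeasure P] in
include hr hb in
theorem measurable_reward_history (t : ℕ) : Measurable fun ω => r (history b t ω) ω :=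
  measurable_apply_of_countable (fun h => ℱ.le t _ (hb.measurableSet_history t h)) hr

include hr hb hK in
theorem integrable_reward_history (t : ℕ) :
    Integrable (fun ω => r (history b (t + 1) ω) ω) P := by
  refine Integrable.of_bound (measurable_reward_history hr hb _).aestronglyMeasurable (K * q ^ t)
    (ae_of_all _ fun ω => ?_)
  simpa [history] using hK (b t ω) (history b t ω) ω

include hq1 hr hK in
theorem abs_value_history_le (t : ℕ) :
    ∀ᵐ ω ∂P, |value P ℱ S hS r (history b t ω) ω| ≤ K * q ^ t / (1 - q) := by
  filter_upwards [ae_all_iff.2 fun h =>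
    abs_value_le (ℱ := ℱ) (hS := hS) (P := P) hq1 hr hK h] with ω hω
  simpa using hω (history b t ω)

omit [IsFiniteMeasure P] in
include hb in
theorem measurable_value_history (t : ℕ) :
    Measurable fun ω => value P ℱ S hS r (history b t ω) ω :=
  measurable_apply_of_countable (fun h => ℱ.le t _ (hb.measurableSet_history t h))
    fun h => (measurable_value h).mono (ℱ.le _) le_rfl

include hq1 hr hK hb in
theorem integrable_value_history (t : ℕ) :
    Integrable (fun ω => value P ℱ S hS r (history b t ω) ω) P :=
  Integrable.of_bound (measurable_value_history hb t).aestronglyMeasurable _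
    (abs_value_history_le hq1 hr hK t)

/-- The optimal expected future reward once the action `x` has been chosen after `h`. -/
noncomputable def actionValue (P : Measure Ω) (ℱ : Filtration ℕ m) (S : List A → Finset A)
    (hS : ∀ h, (S h).Nonempty) (r : List A → Ω → ℝ) (x : A) (h : List A) : Ω → ℝ :=
  P[r (x :: h) + value P ℱ S hS r (x :: h) | ℱ h.length]

/-- The expected reward of period `t` plus that of an optimal continuation is the expectation of
the conditional reward of the action chosen at time `t`. -/
theorem integral_actionValue_history (hq1 : q < 1)
    (hr : ∀ h, Measurable (r h)) (hK : ∀ x h ω, |r (x :: h) ω| ≤ K * q ^ h.length)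
    (hb : AdaptedActions ℱ b) (t : ℕ) :
    ∫ ω, actionValue P ℱ S hS r (b t ω) (history b t ω) ω ∂P =
      ∫ ω, r (history b (t + 1) ω) ω ∂P +
        ∫ ω, value P ℱ S hS r (history b (t + 1) ω) ω ∂P := by
  rw [← integral_add (integrable_reward_history hr hK hb t)
    (integrable_value_history hq1 hr hK hb (t + 1))]
  -- Fixing the length makes the bound uniform over the index and the conditioning σ-algebra equal
  -- to `ℱ t`. The history through time `t` is `ℱ t`-measurable because it includes the action at
  -- time `t` and nothing later.
  let f : {h : List A // h.length = t + 1} → Ω → ℝ := fun h => r h + value P ℱ S hS r h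
  let H : Ω → {h : List A // h.length = t + 1} :=
    fun ω => ⟨history b (t + 1) ω, length_history _ _ _⟩
  have hH : ∀ h, MeasurableSet[ℱ t] {ω | H ω = h} := fun h => by
    have := hb.measurableSet_history_succ t h.1
    simpa only [H, Subtype.ext_iff] using this
  have hC : ∀ h, ∀ᵐ ω ∂P, |f h ω| ≤ K * q ^ t / (1 - q) := by
    rintro ⟨h, hh⟩
    cases h with
    | nil => simp at hh
    | cons x h =>
      have ht : h.length = t := by simpa using hh
      have := abs_reward_add_value_le (ℱ := ℱ) (hS := hS) (P := P) hq1 hr hK x h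
      rwa [ht] at this
  have := integral_condExp_apply (P := P) (ℱ.le t) hH
    (fun h => measurable_reward_add_value (P := P) (ℱ := ℱ) (hS := hS) hr h.1) hC
  simp only [actionValue, length_history]
  exact this

theorem integrable_actionValue_history (hq1 : q < 1)
    (hr : ∀ h, Measurable (r h)) (hK : ∀ x h ω, |r (x :: h) ω| ≤ K * q ^ h.length)
    (hb : AdaptedActions ℱ b) (t : ℕ) :
    Integrable (fun ω => actionValue P ℱ S hS r (b t ω) (history b t ω) ω) P := by
  refine Integrable.of_bound (Measurable.aestronglyMeasurable ?_) (K * q ^ t / (1 - q)) ?_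
  · refine measurable_apply_of_countable (β := A × List A)
      (H := fun ω => (b t ω, history b t ω))
      (f := fun p => actionValue P ℱ S hS r p.1 p.2) (fun p => ?_)
      fun p => (stronglyMeasurable_condExp.mono (ℱ.le _)).measurable
    have : {ω | (b t ω, history b t ω) = p} = {ω | b t ω = p.1} ∩ {ω | history b t ω = p.2} := by
      ext ω; simp [Prod.ext_iff]
    rw [this]
    exact ℱ.le t _ ((hb t _).inter (hb.measurableSet_history t _))
  · filter_upwards [ae_all_iff.2 fun h => ae_all_iff.2 fun x =>
      ae_bdd_abs_condExp_of_ae_bdd_abs (m := ℱ h.length)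
        (abs_reward_add_value_le (ℱ := ℱ) (hS := hS) (P := P) hq1 hr hK x h)] with ω hω
    have := hω (history b t ω) (b t ω)
    simpa [actionValue] using this

theorem integral_reward_add_integral_value_le (hq0 : 0 ≤ q) (hq1 : q < 1)
    (hr : ∀ h, Measurable (r h)) (hK : ∀ x h ω, |r (x :: h) ω| ≤ K * q ^ h.length)
    (hb : AdaptedActions ℱ b) (hbS : ∀ t, ∀ᵐ ω ∂P, b t ω ∈ S (history b t ω)) (t : ℕ) :
    ∫ ω, r (history b (t + 1) ω) ω ∂P + ∫ ω, value P ℱ S hS r (history b (t + 1) ω) ω ∂P ≤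
      ∫ ω, value P ℱ S hS r (history b t ω) ω ∂P := by
  rw [← integral_actionValue_history hq1 hr hK hb]
  refine integral_mono_ae (integrable_actionValue_history hq1 hr hK hb t)
    (integrable_value_history hq1 hr hK hb t) ?_
  filter_upwards [hbS t, ae_all_iff.2 fun h =>
    value_eq_sup' (ℱ := ℱ) (hS := hS) (P := P) hq0 hq1 hr hK h] with ω h1 h2
  rw [h2]
  exact Finset.le_sup' (f := fun x => actionValue P ℱ S hS r x (history b t ω) ω) h1

/-- Actions attaining the maximum in the Bellman equation conserve the value. -/
theorem integral_reward_add_integral_value_eq (hq0 : 0 ≤ q) (hq1 : q < 1)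
    (hr : ∀ h, Measurable (r h)) (hK : ∀ x h ω, |r (x :: h) ω| ≤ K * q ^ h.length)
    (hb : AdaptedActions ℱ b)
    (hmax : ∀ t ω, (S (history b t ω)).sup' (hS _)
      (fun x => actionValue P ℱ S hS r x (history b t ω) ω) =
        actionValue P ℱ S hS r (b t ω) (history b t ω) ω) (t : ℕ) :
    ∫ ω, r (history b (t + 1) ω) ω ∂P + ∫ ω, value P ℱ S hS r (history b (t + 1) ω) ω ∂P =
      ∫ ω, value P ℱ S hS r (history b t ω) ω ∂P := by
  rw [← integral_actionValue_history hq1 hr hK hb]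
  refine integral_congr_ae ?_
  filter_upwards [ae_all_iff.2 fun h =>
    value_eq_sup' (ℱ := ℱ) (hS := hS) (P := P) hq0 hq1 hr hK h] with ω h2
  rw [h2]
  exact (hmax t ω).symm

/-- The residual value after `T` periods is of order `q ^ T`. Along this sequence, feasible actions
can only lose value and maximizing actions keep it constant, which gives the two verification
results below. -/
theorem tendsto_sum_integral_add_integral_value (hq0 : 0 ≤ q) (hq1 : q < 1)
    (hr : ∀ h, Measurable (r h)) (hK : ∀ x h ω, |r (x :: h) ω| ≤ K * q ^ h.length)
    (hb : AdaptedActions ℱ b) :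
    Tendsto (fun T => ∑ t ∈ Finset.range T, ∫ ω, r (history b (t + 1) ω) ω ∂P +
      ∫ ω, value P ℱ S hS r (history b T ω) ω ∂P) atTop
      (𝓝 (∫ ω, ∑' t, r (history b (t + 1) ω) ω ∂P)) := by
  have hsum : Summable fun t : ℕ => K * q ^ t :=
    (summable_geometric_of_lt_one hq0 hq1).mul_left K
  have hbd : ∀ t ω, ‖r (history b (t + 1) ω) ω‖ ≤ K * q ^ t := fun t ω => by
    simpa [history] using hK (b t ω) (history b t ω) ω
  have h1 := hasSum_integral_of_dominated_convergence (μ := P)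
    (F := fun t ω => r (history b (t + 1) ω) ω)
    (f := fun ω => ∑' t, r (history b (t + 1) ω) ω) (fun t _ => K * q ^ t)
    (fun t => (integrable_reward_history hr hK hb t).aestronglyMeasurable)
    (fun t => ae_of_all _ (hbd t)) (ae_of_all _ fun _ => hsum) (integrable_const _)
    (ae_of_all _ fun ω => (Summable.of_norm_bounded hsum (fun t => hbd t ω)).hasSum)
  have h2 : Tendsto (fun T => ∫ ω, value P ℱ S hS r (history b T ω) ω ∂P) atTop (𝓝 0) := by
    have hlim : Tendsto (fun t : ℕ => K * q ^ t / (1 - q) * P.real Set.univ) atTop (𝓝 0) := by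
      have := (((tendsto_pow_atTop_nhds_zero_of_lt_one hq0 hq1).const_mul K).div_const
        (1 - q)).mul_const (P.real Set.univ)
      simpa using this
    refine squeeze_zero_norm (fun T => ?_) hlim
    exact norm_integral_le_of_norm_le_const (abs_value_history_le hq1 hr hK T)
  simpa using h1.tendsto_sum_nat.add h2

theorem integral_tsum_reward_le (hq0 : 0 ≤ q) (hq1 : q < 1)
    (hr : ∀ h, Measurable (r h)) (hK : ∀ x h ω, |r (x :: h) ω| ≤ K * q ^ h.length)
    (hb : AdaptedActions ℱ b) (hbS : ∀ t, ∀ᵐ ω ∂P, b t ω ∈ S (history b t ω)) :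
    ∫ ω, ∑' t, r (history b (t + 1) ω) ω ∂P ≤ ∫ ω, value P ℱ S hS r [] ω ∂P := by
  refine le_of_tendsto (tendsto_sum_integral_add_integral_value (hS := hS) hq0 hq1 hr hK hb)
    (Eventually.of_forall fun T => ?_)
  induction T with
  | zero => simp [history]
  | succ T ih =>
    rw [Finset.sum_range_succ]
    have := integral_reward_add_integral_value_le (hS := hS) hq0 hq1 hr hK hb hbS T
    linarith

theorem integral_tsum_reward_eq (hq0 : 0 ≤ q) (hq1 : q < 1)
    (hr : ∀ h, Measurable (r h)) (hK : ∀ x h ω, |r (x :: h) ω| ≤ K * q ^ h.length)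
    (hb : AdaptedActions ℱ b)
    (hmax : ∀ t ω, (S (history b t ω)).sup' (hS _)
      (fun x => actionValue P ℱ S hS r x (history b t ω) ω) =
        actionValue P ℱ S hS r (b t ω) (history b t ω) ω) :
    ∫ ω, ∑' t, r (history b (t + 1) ω) ω ∂P = ∫ ω, value P ℱ S hS r [] ω ∂P := by
  refine tendsto_nhds_unique
    (tendsto_sum_integral_add_integral_value (hS := hS) hq0 hq1 hr hK hb)
    (tendsto_const_nhds.congr fun T => ?_)
  induction T with
  | zero => simp [history]
  | succ T ih =>
    rw [Finset.sum_range_succ]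
    have := integral_reward_add_integral_value_eq (hS := hS) hq0 hq1 hr hK hb hmax T
    linarith

/-- In a discounted control problem with finitely many actions in each period, whose rewards and
constraints depend on the past actions, there is an optimal adapted process of actions. -/
theorem exists_optimal_actions (P : Measure Ω) [IsFiniteMeasure P] (ℱ : Filtration ℕ m)
    {S : List A → Finset A} (hS : ∀ h, (S h).Nonempty) (hq0 : 0 ≤ q) (hq1 : q < 1)
    (hr : ∀ h, Measurable (r h)) (hK : ∀ x h ω, |r (x :: h) ω| ≤ K * q ^ h.length) :
    ∃ a : ℕ → Ω → A, AdaptedActions ℱ a ∧ (∀ t ω, a t ω ∈ S (history a t ω)) ∧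
      ∀ b : ℕ → Ω → A, AdaptedActions ℱ b → (∀ t, ∀ᵐ ω ∂P, b t ω ∈ S (history b t ω)) →
        ∫ ω, ∑' t, r (history b (t + 1) ω) ω ∂P ≤ ∫ ω, ∑' t, r (history a (t + 1) ω) ω ∂P := by
  have hex : ∀ h : List A, ∃ c : Ω → A, (∀ x, MeasurableSet[ℱ h.length] {ω | c ω = x}) ∧
      (∀ ω, c ω ∈ S h) ∧ ∀ ω, (S h).sup' (hS h) (fun x => actionValue P ℱ S hS r x h ω) =
        actionValue P ℱ S hS r (c ω) h ω := fun h =>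
    @exists_measurable_argmax Ω A (ℱ h.length) (S h) (hS h)
      (fun x => actionValue P ℱ S hS r x h) fun x => stronglyMeasurable_condExp.measurable
  choose c hc hcS hcmax using hex
  -- The maximizer depends on the actions it has itself produced, so the history is built first, by
  -- recursion, and the actions are read off from it.
  let past : ℕ → Ω → List A := fun t ω => Nat.rec [] (fun _ h => c h ω :: h) t
  let a : ℕ → Ω → A := fun t ω => c (past t ω) ω
  have hpast : ∀ t ω, history a t ω = past t ω := by
    intro t ω
    induction t with
    | zero => rfl
    | succ t ih => simp only [history, ih]; rfl
  have ha : ∀ t ω, a t ω = c (history a t ω) ω := fun t ω => by rw [hpast]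
  have hhist : ∀ t, (∀ h, MeasurableSet[ℱ t] {ω | history a t ω = h}) →
      ∀ x, MeasurableSet[ℱ t] {ω | a t ω = x} := by
    intro t ht x
    have : {ω | a t ω = x} = ⋃ h : {h : List A // h.length = t},
        {ω | history a t ω = h} ∩ {ω | c h ω = x} := by
      ext ω
      simp [ha]
    rw [this]
    refine MeasurableSet.iUnion fun h => (ht h).inter ?_
    have := hc h x
    rwa [h.2] at this
  have hhist' : ∀ t h, MeasurableSet[ℱ t] {ω | history a t ω = h} := by
    intro t
    induction t with
    | zero => intro h; simp only [history]; exact MeasurableSet.const _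
    | succ t ih =>
      exact fun h => ℱ.mono t.le_succ _
        (measurableSet_history_succ (m := ℱ t) (hhist t ih) ih h)
  have had : AdaptedActions ℱ a := fun t => hhist t (hhist' t)
  refine ⟨a, had, fun t ω => by rw [ha]; exact hcS _ _, fun b hb hbS => ?_⟩
  rw [integral_tsum_reward_eq (hS := hS) hq0 hq1 hr hK had fun t ω => by
    rw [ha]; exact hcmax _ _]
  exact integral_tsum_reward_le hq0 hq1 hr hK hb hbS

end Verification

/-! ### Recoding a path of a strategy as one action per time. -/

section Pathwise

variable {Ω : Type*} {d : ℕ} {Δ : ℕ} {δ : Strategy Ω d} {ω : Ω}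

/-- Along the path `ω`, consecutive decision times are at least `Δ` apart. -/
def Strategy.HasGaps (δ : Strategy Ω d) (Δ : ℕ) (ω : Ω) : Prop :=
  ∀ p, δ.τ p ω + (Δ : WithTop ℕ) ≤ δ.τ (p + 1) ω

theorem Strategy.HasGaps.mono (h : δ.HasGaps Δ ω) : Monotone fun p => δ.τ p ω :=
  monotone_nat_of_le_succ fun p => le_trans le_self_add (h p)

theorem Strategy.HasGaps.add_le (h : δ.HasGaps Δ ω) {p q : ℕ} (hpq : p < q) :
    δ.τ p ω + (Δ : WithTop ℕ) ≤ δ.τ q ω :=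
  (h p).trans (h.mono hpq)

theorem Strategy.HasGaps.mul_le (h : δ.HasGaps Δ ω) (p : ℕ) :
    ((p * Δ : ℕ) : WithTop ℕ) ≤ δ.τ p ω := by
  induction p with
  | zero => simp
  | succ p ih =>
    refine le_trans ?_ (h p)
    rw [Nat.succ_mul, Nat.cast_add]
    exact add_le_add_left ih _

theorem Strategy.HasGaps.le (h : δ.HasGaps Δ ω) (hΔ : 0 < Δ) {p t : ℕ}
    (hp : δ.τ p ω ≤ (t : WithTop ℕ)) : p ≤ t := by
  have h1 := (h.mul_le p).trans hp
  have h2 : p * Δ ≤ t := by exact_mod_cast h1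
  exact (Nat.le_mul_of_pos_right p hΔ).trans h2

theorem Strategy.HasGaps.eq_of_eq (h : δ.HasGaps Δ ω) (hΔ : 0 < Δ) {p q t : ℕ}
    (hp : δ.τ p ω = (t : WithTop ℕ)) (hq : δ.τ q ω = (t : WithTop ℕ)) : p = q := by
  have key : ∀ p q, δ.τ p ω = (t : WithTop ℕ) → δ.τ q ω = (t : WithTop ℕ) → ¬ p < q := by
    intro p q hp hq hlt
    have h1 := h.add_le hlt
    rw [hp, hq] at h1
    have h2 : t + Δ ≤ t := by exact_mod_cast h1
    omega
  rcases lt_trichotomy p q with h1 | h1 | h1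
  · exact absurd h1 (key p q hp hq)
  · exact h1
  · exact absurd h1 (key q p hq hp)

theorem Strategy.HasGaps.controlled_eq (h : δ.HasGaps Δ ω) (hΔ : 0 < Δ)
    (X : ℕ → Ω → EuclideanSpace ℝ (Fin d)) (k : ℕ) :
    controlled Δ X δ k ω = X k ω + ∑ p ∈ Finset.range (k + 1),
      if δ.τ p ω + (Δ : WithTop ℕ) ≤ (k : WithTop ℕ) then δ.ξ p ω else 0 := by
  classical
  have hk : (k : WithTop ℕ) < δ.τ (k + 1) ω + (Δ : WithTop ℕ) := by
    by_contra! hc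
    have := h.le hΔ (le_trans le_self_add hc)
    omega
  have hex : ∃ L, (k : WithTop ℕ) < δ.τ L ω + (Δ : WithTop ℕ) := ⟨_, hk⟩
  -- `L` is the number of impulses in effect at time `k`. By monotonicity they are those of index
  -- below `L`, so only the index `L - 1` contributes to the series.
  obtain ⟨L, hL, hmin⟩ : ∃ L, ((k : WithTop ℕ) < δ.τ L ω + (Δ : WithTop ℕ)) ∧
      ∀ p < L, δ.τ p ω + (Δ : WithTop ℕ) ≤ (k : WithTop ℕ) :=
    ⟨Nat.find hex, Nat.find_spec hex, fun p hp => not_lt.1 (Nat.find_min hex hp)⟩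
  have hge : ∀ p, L ≤ p → ¬ δ.τ p ω + (Δ : WithTop ℕ) ≤ (k : WithTop ℕ) := fun p hp =>
    not_le.2 (hL.trans_le (add_le_add_left (h.mono hp) _))
  have hLk : L ≤ k + 1 := by
    by_contra! hc
    exact absurd (hmin _ hc) (not_le.2 hk)
  have hiff : ∀ p, δ.τ p ω + (Δ : WithTop ℕ) ≤ (k : WithTop ℕ) ↔ p < L := fun p =>
    ⟨fun hp => by by_contra! hc; exact hge p hc hp, hmin p⟩
  have hfilter : (Finset.range (k + 1)).filter (fun p => p < L) = Finset.range L := by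
    ext p; simp only [Finset.mem_filter, Finset.mem_range]; omega
  have hlt : ∀ p, (k : WithTop ℕ) < δ.τ p ω + (Δ : WithTop ℕ) ↔ L ≤ p := fun p => by
    rw [← not_le, hiff, not_lt]
  simp only [controlled, hiff, hlt]
  rw [← Finset.sum_filter, hfilter]
  cases L with
  | zero => simp
  | succ L =>
    rw [tsum_eq_single L]
    · simp
    · intro l hl
      rw [if_neg]
      omega

variable {U : Finset (EuclideanSpace ℝ (Fin d))}

-- Almost surely at most one index has `τ_p = t`. Taking the least index keeps the process adapted
-- on the exceptional null set too, which matters because the filtration need not be complete.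
open Classical in
/-- The process of actions of a strategy: the impulse ordered at time `t`, if any. -/
noncomputable def Strategy.actions (δ : Strategy Ω d) (U : Finset (EuclideanSpace ℝ (Fin d)))
    (t : ℕ) (ω : Ω) : Option {u // u ∈ U} :=
  if h : ∃ p, δ.τ p ω = (t : WithTop ℕ) ∧ δ.ξ p ω ∈ U then
    some ⟨δ.ξ (Nat.find h) ω, (Nat.find_spec h).2⟩
  else none

theorem Strategy.actions_eq_none_iff (hU : ∀ p ω, δ.ξ p ω ∈ U) {t : ℕ} :
    δ.actions U t ω = none ↔ ∀ p, δ.τ p ω ≠ (t : WithTop ℕ) := by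
  classical
  simp [actions, hU]

theorem Strategy.actions_eq_some_iff (hU : ∀ p ω, δ.ξ p ω ∈ U) {t : ℕ} {x : {u // u ∈ U}} :
    δ.actions U t ω = some x ↔
      ∃ p, δ.τ p ω = (t : WithTop ℕ) ∧ δ.ξ p ω = x ∧ ∀ q < p, δ.τ q ω ≠ (t : WithTop ℕ) := by
  classical
  constructor
  · intro h
    unfold actions at h
    split_ifs at h with hex
    refine ⟨Nat.find hex, (Nat.find_spec hex).1, ?_, fun q hq hqt =>
      Nat.find_min hex hq ⟨hqt, hU _ _⟩⟩
    rw [← Option.some.inj h]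
  · rintro ⟨p, hp, hx, hmin⟩
    have hex : ∃ p, δ.τ p ω = (t : WithTop ℕ) ∧ δ.ξ p ω ∈ U := ⟨p, hp, hU _ _⟩
    have hf : Nat.find hex = p :=
      (Nat.find_eq_iff hex).2 ⟨⟨hp, hU _ _⟩, fun q hq hc => hmin q hq hc.1⟩
    unfold actions
    rw [dif_pos hex]
    congr 1
    ext1
    rw [← hx]
    exact congrArg (fun i => δ.ξ i ω) hf

theorem Strategy.HasGaps.actions_eq_some (h : δ.HasGaps Δ ω) (hΔ : 0 < Δ)
    (hU : ∀ p ω, δ.ξ p ω ∈ U) {p t : ℕ} (hp : δ.τ p ω = (t : WithTop ℕ)) :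
    δ.actions U t ω = some ⟨δ.ξ p ω, hU p ω⟩ :=
  (actions_eq_some_iff hU).2 ⟨p, hp, rfl, fun _ hq hc => hq.ne (h.eq_of_eq hΔ hc hp)⟩

/-- The jump caused by an action. -/
def jump : Option {u // u ∈ U} → EuclideanSpace ℝ (Fin d)
  | none => 0
  | some u => u

/-- The undiscounted cost of an action. -/
def actionCost (Ψ : EuclideanSpace ℝ (Fin d) → ℝ) : Option {u // u ∈ U} → ℝ
  | none => 0
  | some u => Ψ u

theorem Strategy.HasGaps.sum_jump_actions (h : δ.HasGaps Δ ω) (hΔ : 0 < Δ)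
    (hU : ∀ p ω, δ.ξ p ω ∈ U) (k : ℕ) :
    ∑ s ∈ Finset.range (k + 1 - Δ), jump (δ.actions U s ω) = ∑ p ∈ Finset.range (k + 1),
      if δ.τ p ω + (Δ : WithTop ℕ) ≤ (k : WithTop ℕ) then δ.ξ p ω else 0 := by
  classical
  -- The impulses in effect at time `k` are those ordered at some `s` with `s + Δ ≤ k`; truncated
  -- subtraction leaves an empty range when `k < Δ`.
  have h1 : ∀ s ∈ Finset.range (k + 1 - Δ), jump (δ.actions U s ω) =
      ∑ p ∈ Finset.range (k + 1), if δ.τ p ω = (s : WithTop ℕ) then δ.ξ p ω else 0 := by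
    intro s hs
    by_cases hex : ∃ p, δ.τ p ω = (s : WithTop ℕ)
    · obtain ⟨p, hp⟩ := hex
      have hpk : p ∈ Finset.range (k + 1) := by
        have := h.le hΔ hp.le
        simp only [Finset.mem_range] at hs ⊢
        omega
      rw [h.actions_eq_some hΔ hU hp, Finset.sum_eq_single_of_mem p hpk, if_pos hp]
      · rfl
      · exact fun q _ hq => if_neg fun hc => hq (h.eq_of_eq hΔ hc hp)
    · push Not at hex
      rw [(actions_eq_none_iff hU).2 hex, Finset.sum_eq_zero fun p _ => if_neg (hex p)]
      rfl
  rw [Finset.sum_congr rfl h1, Finset.sum_comm]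
  refine Finset.sum_congr rfl fun p _ => ?_
  rcases eq_or_ne (δ.τ p ω) ⊤ with hp | hp
  · simp [hp]
  · obtain ⟨t, ht⟩ : ∃ t : ℕ, δ.τ p ω = (t : WithTop ℕ) := ⟨_, (WithTop.coe_untop _ hp).symm⟩
    have e1 : ∀ s : ℕ, ((t : WithTop ℕ) = (s : WithTop ℕ)) ↔ t = s := fun s => by norm_cast
    have e2 : ((t : WithTop ℕ) + (Δ : WithTop ℕ) ≤ (k : WithTop ℕ)) ↔
        t ∈ Finset.range (k + 1 - Δ) := by
      rw [Finset.mem_range]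
      have : ((t : WithTop ℕ) + (Δ : WithTop ℕ) ≤ (k : WithTop ℕ)) ↔ t + Δ ≤ k := by norm_cast
      rw [this]; omega
    simp only [ht, e1, e2]
    rw [Finset.sum_ite_eq]

theorem Strategy.HasGaps.tsum_cost_actions (h : δ.HasGaps Δ ω) (hΔ : 0 < Δ)
    (hU : ∀ p ω, δ.ξ p ω ∈ U) (θ : ℝ) (Ψ : EuclideanSpace ℝ (Fin d) → ℝ) :
    ∑' l : ℕ, discount θ (δ.τ l ω + (Δ : WithTop ℕ)) * Ψ (δ.ξ l ω) =
      ∑' t : ℕ, Real.exp (-θ * ((t + Δ : ℕ) : ℝ)) * actionCost Ψ (δ.actions U t ω) := by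
  let s : Set ℕ := {l | δ.τ l ω ≠ ⊤}
  have hs : ∀ l : s, δ.τ l ω = (((δ.τ l ω).untop l.2 : ℕ) : WithTop ℕ) :=
    fun l => (WithTop.coe_untop _ l.2).symm
  let i : s → ℕ := fun l => (δ.τ l ω).untop l.2
  have hi : Function.Injective i := by
    intro l l' hll
    refine Subtype.ext (h.eq_of_eq hΔ (hs l) ?_)
    rw [hs l']
    exact congrArg _ hll.symm
  -- Both series live on the finite decision times: `l ↦ τ_l` is injective there, and all other
  -- terms vanish.
  rw [← tsum_subtype_eq_of_support_subset (s := s), ← hi.tsum_eq]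
  · refine tsum_congr fun l => ?_
    rw [h.actions_eq_some hΔ hU (hs l)]
    have : δ.τ l ω + (Δ : WithTop ℕ) = ((i l + Δ : ℕ) : WithTop ℕ) := by
      rw [Nat.cast_add]; exact congrArg (· + (Δ : WithTop ℕ)) (hs l)
    rw [this]
    rfl
  · intro t ht
    by_contra hc
    refine ht ?_
    have : δ.actions U t ω = none := (actions_eq_none_iff hU).2 fun p hp =>
      hc ⟨⟨p, by simp [s, hp]⟩, (WithTop.untop_eq_iff _).2 hp⟩
    simp [this, actionCost]
  · intro l hl hc
    refine hl ?_
    simp [hc, discount]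

/-- The discounted reward of the period in which the most recent of the given actions was taken;
the cost of an impulse is charged when it is ordered. -/
noncomputable def reward (Δ : ℕ) (θ : ℝ) (U : Finset (EuclideanSpace ℝ (Fin d)))
    (g Ψ : EuclideanSpace ℝ (Fin d) → ℝ) (X : ℕ → Ω → EuclideanSpace ℝ (Fin d)) :
    List (Option {u // u ∈ U}) → Ω → ℝ
  | [], _ => 0
  | x :: h, ω => Real.exp (-θ * (h.length : ℝ)) *
      g (X h.length ω + (((x :: h).drop Δ).map jump).sum) -
      Real.exp (-θ * ((h.length + Δ : ℕ) : ℝ)) * actionCost Ψ x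

theorem drop_history {A : Type*} (a : ℕ → Ω → A) (t k : ℕ) (ω : Ω) :
    (history a t ω).drop k = history a (t - k) ω := by
  induction k generalizing t with
  | zero => simp
  | succ k ih =>
    cases t with
    | zero => simp [history]
    | succ t => simp [history, ih]

theorem sum_map_history {A : Type*} (a : ℕ → Ω → A) (f : A → EuclideanSpace ℝ (Fin d)) (t : ℕ)
    (ω : Ω) : ((history a t ω).map f).sum = ∑ s ∈ Finset.range t, f (a s ω) := by
  induction t with
  | zero => simp [history]
  | succ t ih => rw [Finset.sum_range_succ, ← ih, history, List.map_cons, List.sum_cons, add_comm]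

variable {θ : ℝ} {g Ψ : EuclideanSpace ℝ (Fin d) → ℝ} {X : ℕ → Ω → EuclideanSpace ℝ (Fin d)}

theorem exp_neg_mul_nat (θ : ℝ) (k : ℕ) : Real.exp (-θ * (k : ℝ)) = Real.exp (-θ) ^ k := by
  rw [← Real.exp_nat_mul, mul_comm]

theorem abs_actionCost_le (x : Option {u // u ∈ U}) :
    |actionCost Ψ x| ≤ ⨆ u : {u // u ∈ U}, |Ψ u| := by
  cases x with
  | none =>
    simp only [actionCost, abs_zero]
    exact Real.iSup_nonneg fun _ => abs_nonneg _
  | some u => exact le_ciSup (f := fun u : {u // u ∈ U} => |Ψ u|) (Set.finite_range _).bddAbove u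

theorem abs_le_iSup_abs (hg_bdd : ∃ M : ℝ, ∀ x, |g x| ≤ M) (x : EuclideanSpace ℝ (Fin d)) :
    |g x| ≤ ⨆ x, |g x| := by
  obtain ⟨M, hM⟩ := hg_bdd
  exact le_ciSup (f := fun x => |g x|) ⟨M, by rintro _ ⟨y, rfl⟩; exact hM y⟩ x

theorem abs_exp_mul_le (hg_bdd : ∃ M : ℝ, ∀ x, |g x| ≤ M) (k : ℕ)
    (x : EuclideanSpace ℝ (Fin d)) :
    |Real.exp (-θ * (k : ℝ)) * g x| ≤ (⨆ x, |g x|) * Real.exp (-θ) ^ k := by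
  rw [abs_mul, Real.abs_exp, exp_neg_mul_nat, mul_comm]
  exact mul_le_mul_of_nonneg_right (abs_le_iSup_abs hg_bdd x) (by positivity)

theorem abs_exp_mul_actionCost_le (hθ : 0 < θ) (t : ℕ) (x : Option {u // u ∈ U}) :
    |Real.exp (-θ * ((t + Δ : ℕ) : ℝ)) * actionCost Ψ x| ≤
      (⨆ u : {u // u ∈ U}, |Ψ u|) * Real.exp (-θ) ^ t := by
  rw [abs_mul, Real.abs_exp, exp_neg_mul_nat, mul_comm]
  refine mul_le_mul (abs_actionCost_le x) ?_ (by positivity)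
    (Real.iSup_nonneg fun _ => abs_nonneg _)
  exact pow_le_pow_of_le_one (Real.exp_pos _).le (Real.exp_le_one_iff.2 (by linarith)) (by omega)

theorem abs_reward_cons_le (hθ : 0 < θ) (hg_bdd : ∃ M : ℝ, ∀ x, |g x| ≤ M)
    (x : Option {u // u ∈ U}) (h : List (Option {u // u ∈ U})) (ω : Ω) :
    |reward Δ θ U g Ψ X (x :: h) ω| ≤
      ((⨆ x, |g x|) + ⨆ u : {u // u ∈ U}, |Ψ u|) * Real.exp (-θ) ^ h.length := by
  rw [add_mul]
  exact (abs_sub _ _).trans (add_le_add (abs_exp_mul_le hg_bdd _ _)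
    (abs_exp_mul_actionCost_le hθ _ _))

theorem measurable_reward {m : MeasurableSpace Ω} (hX : ∀ k, Measurable (X k))
    (hg : Measurable g) (h : List (Option {u // u ∈ U})) :
    Measurable (reward Δ θ U g Ψ X h) := by
  cases h with
  | nil => exact measurable_const
  | cons x h =>
    exact ((hg.comp ((hX _).add measurable_const)).const_mul _).sub measurable_const

theorem Strategy.HasGaps.totalPayoff_eq (h : δ.HasGaps Δ ω) (hΔ : 0 < Δ) (hθ : 0 < θ)
    (hU : ∀ p ω, δ.ξ p ω ∈ U) (hg_bdd : ∃ M : ℝ, ∀ x, |g x| ≤ M) :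
    totalPayoff Δ θ g Ψ X δ ω =
      ∑' t, reward Δ θ U g Ψ X (history (δ.actions U) (t + 1) ω) ω := by
  have hq : Summable fun t : ℕ => Real.exp (-θ) ^ t :=
    summable_geometric_of_lt_one (Real.exp_pos _).le (Real.exp_lt_one_iff.2 (by linarith))
  rw [totalPayoff, h.tsum_cost_actions hΔ hU, ← Summable.tsum_sub]
  · refine tsum_congr fun t => ?_
    have : history (δ.actions U) (t + 1) ω =
      δ.actions U t ω :: history (δ.actions U) t ω := rfl
    rw [this, reward, ← this, drop_history, sum_map_history, length_history,
      h.sum_jump_actions hΔ hU, h.controlled_eq hΔ]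
  · exact Summable.of_norm_bounded (hq.mul_left _) fun t => abs_exp_mul_le hg_bdd t _
  · exact Summable.of_norm_bounded (hq.mul_left _) fun t => abs_exp_mul_actionCost_le hθ t _

end Pathwise

/-! ### Gap and number constraints expressed through past actions. -/

section Feasibility

variable {Ω : Type*} {d : ℕ} {Δ : ℕ} {U : Finset (EuclideanSpace ℝ (Fin d))}

open Classical in
/-- The actions allowed after given past actions: an impulse may be ordered if none has been
ordered in the last `Δ - 1` periods and less than `n` have been ordered so far. -/
noncomputable def allowed (Δ n : ℕ) (U : Finset (EuclideanSpace ℝ (Fin d)))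
    (h : List (Option {u // u ∈ U})) : Finset (Option {u // u ∈ U}) :=
  Finset.univ.filter fun x =>
    x = none ∨ (∀ y ∈ h.take (Δ - 1), y = none) ∧ h.countP Option.isSome < n

theorem mem_allowed {n : ℕ} {h : List (Option {u // u ∈ U})} {x : Option {u // u ∈ U}} :
    x ∈ allowed Δ n U h ↔
      x = none ∨ (∀ y ∈ h.take (Δ - 1), y = none) ∧ h.countP Option.isSome < n := by
  simp [allowed]

theorem allowed_nonempty (Δ n : ℕ) (U : Finset (EuclideanSpace ℝ (Fin d)))
    (h : List (Option {u // u ∈ U})) : (allowed Δ n U h).Nonempty :=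
  ⟨none, mem_allowed.2 (Or.inl rfl)⟩

theorem mem_take_history {A : Type*} {b : ℕ → Ω → A} {t k : ℕ} {ω : Ω} {y : A} :
    y ∈ (history b t ω).take k ↔ ∃ s, s < t ∧ t ≤ s + k ∧ b s ω = y := by
  induction t generalizing k with
  | zero => simp [history]
  | succ t ih =>
    cases k with
    | zero =>
      simp only [List.take_zero, List.not_mem_nil, false_iff, not_exists]
      intro s hs
      omega
    | succ k =>
      rw [history, List.take_succ_cons, List.mem_cons, ih]
      constructor
      · rintro (rfl | ⟨s, h1, h2, h3⟩)
        · exact ⟨t, by omega, by omega, rfl⟩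
        · exact ⟨s, by omega, by omega, h3⟩
      · rintro ⟨s, h1, h2, h3⟩
        rcases (Nat.lt_succ_iff_lt_or_eq.1 h1) with h4 | rfl
        · exact Or.inr ⟨s, h4, by omega, h3⟩
        · exact Or.inl h3.symm

/-- The number of impulses ordered before time `t`. -/
def orderCount (a : ℕ → Ω → Option {u // u ∈ U}) (t : ℕ) (ω : Ω) : ℕ :=
  (history a t ω).countP Option.isSome

@[simp] theorem orderCount_zero (a : ℕ → Ω → Option {u // u ∈ U}) (ω : Ω) :
    orderCount a 0 ω = 0 := rfl

theorem orderCount_succ_of_none {a : ℕ → Ω → Option {u // u ∈ U}} {t : ℕ} {ω : Ω}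
    (h : a t ω = none) : orderCount a (t + 1) ω = orderCount a t ω := by
  simp [orderCount, history, h]

theorem orderCount_succ_of_ne_none {a : ℕ → Ω → Option {u // u ∈ U}} {t : ℕ} {ω : Ω}
    (h : a t ω ≠ none) : orderCount a (t + 1) ω = orderCount a t ω + 1 := by
  obtain ⟨u, hu⟩ := Option.ne_none_iff_exists'.1 h
  simp [orderCount, history, hu]

theorem orderCount_mono (a : ℕ → Ω → Option {u // u ∈ U}) (ω : Ω) :
    Monotone fun t => orderCount a t ω := by
  refine monotone_nat_of_le_succ fun t => ?_
  by_cases h : a t ω = none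
  · rw [orderCount_succ_of_none h]
  · rw [orderCount_succ_of_ne_none h]; omega

theorem Strategy.HasGaps.actions_mem_allowed {δ : Strategy Ω d} {ω : Ω} {n : ℕ}
    (h : δ.HasGaps Δ ω) (hΔ : 0 < Δ) (hU : ∀ p ω, δ.ξ p ω ∈ U) (hn : δ.τ n ω = ⊤) (t : ℕ) :
    δ.actions U t ω ∈ allowed Δ n U (history (δ.actions U) t ω) := by
  have hex : ∀ s, δ.actions U s ω ≠ none → ∃ p, δ.τ p ω = (s : WithTop ℕ) := by
    intro s hs
    by_contra! hc
    exact hs ((actions_eq_none_iff hU).2 hc)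
  have hlt : ∀ p q s t : ℕ, δ.τ p ω = (s : WithTop ℕ) → δ.τ q ω = (t : WithTop ℕ) → s < t →
      p < q ∧ s + Δ ≤ t := by
    intro p q s t hp hq hst
    have hpq : p < q := by
      by_contra! hc
      have := h.mono hc
      simp only [hp, hq] at this
      have : t ≤ s := by exact_mod_cast this
      omega
    have := h.add_le hpq
    rw [hp, hq] at this
    exact ⟨hpq, by exact_mod_cast this⟩
  -- Impulses ordered before `t` occupy distinct indices. If these all lie below `q`, there are at
  -- most `q` of them.
  have hcount : ∀ t q, (∀ p s : ℕ, δ.τ p ω = (s : WithTop ℕ) → s < t → p < q) →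
      orderCount (δ.actions U) t ω ≤ q := by
    intro t
    induction t with
    | zero => simp
    | succ t ih =>
      intro q hq
      by_cases hnone : δ.actions U t ω = none
      · rw [orderCount_succ_of_none hnone]
        exact ih q fun p s hp hs => hq p s hp (by omega)
      · rw [orderCount_succ_of_ne_none hnone]
        obtain ⟨p, hp⟩ := hex t hnone
        have h1 := ih p fun p' s hp' hs => (hlt p' p s t hp' hp hs).1
        have h2 := hq p t hp (by omega)
        omega
  rw [mem_allowed]
  by_cases hnone : δ.actions U t ω = none
  · exact Or.inl hnone
  obtain ⟨p, hp⟩ := hex t hnone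
  refine Or.inr ⟨fun y hy => ?_, ?_⟩
  · obtain ⟨s, h1, h2, rfl⟩ := mem_take_history.1 hy
    by_contra hc
    obtain ⟨q, hq⟩ := hex s hc
    have := (hlt q p s t hq hp h1).2
    omega
  · have h1 := hcount t p fun p' s hp' hs => (hlt p' p s t hp' hp hs).1
    refine lt_of_le_of_lt h1 ?_
    by_contra! hc
    have := h.mono hc
    simp only [hp, hn, top_le_iff] at this
    exact WithTop.coe_ne_top this

end Feasibility

/-! ### From actions back to strategies. -/

section StrategyOfActions

variable {Ω : Type*} {d : ℕ} {Δ : ℕ} {U : Finset (EuclideanSpace ℝ (Fin d))}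

open Classical in
/-- The strategy carrying out a process of actions; `u₀` is the impulse of an order that is
never placed. -/
noncomputable def strategyOfActions (u₀ : EuclideanSpace ℝ (Fin d))
    (a : ℕ → Ω → Option {u // u ∈ U}) : Strategy Ω d where
  τ p ω := if h : ∃ t, p < orderCount a (t + 1) ω then ((Nat.find h : ℕ) : WithTop ℕ) else ⊤
  ξ p ω := if h : ∃ t, p < orderCount a (t + 1) ω then (a (Nat.find h) ω).elim u₀ (↑) else u₀

variable {u₀ : EuclideanSpace ℝ (Fin d)} {a : ℕ → Ω → Option {u // u ∈ U}} {p t : ℕ} {ω : Ω}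

theorem strategyOfActions_τ_eq_iff :
    (strategyOfActions u₀ a).τ p ω = (t : WithTop ℕ) ↔ orderCount a t ω = p ∧ a t ω ≠ none := by
  classical
  simp only [strategyOfActions]
  constructor
  · intro h
    split_ifs at h with hex
    swap
    · exact absurd h.symm (WithTop.natCast_ne_top _)
    have ht : Nat.find hex = t := by exact_mod_cast h
    obtain ⟨h1, h2⟩ := (Nat.find_eq_iff hex).1 ht
    have h3 : orderCount a t ω ≤ p := by
      cases t with
      | zero => simp
      | succ t => exact not_lt.1 (h2 t t.lt_succ_self)
    have hne : a t ω ≠ none := fun hc => by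
      rw [orderCount_succ_of_none hc] at h1; omega
    rw [orderCount_succ_of_ne_none hne] at h1
    exact ⟨by omega, hne⟩
  · rintro ⟨rfl, hne⟩
    have hex : ∃ s, orderCount a t ω < orderCount a (s + 1) ω :=
      ⟨t, by rw [orderCount_succ_of_ne_none hne]; omega⟩
    rw [dif_pos hex]
    norm_cast
    refine (Nat.find_eq_iff hex).2 ⟨by rw [orderCount_succ_of_ne_none hne]; omega, ?_⟩
    intro s hs
    exact not_lt.2 (orderCount_mono a ω hs)

theorem strategyOfActions_τ_lt (h : p < orderCount a t ω) :
    ∃ s < t, (strategyOfActions u₀ a).τ p ω = (s : WithTop ℕ) := by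
  classical
  cases t with
  | zero => simp at h
  | succ t =>
    have hex : ∃ s, p < orderCount a (s + 1) ω := ⟨t, h⟩
    exact ⟨Nat.find hex, Nat.lt_succ_of_le (Nat.find_min' hex h), by
      simp only [strategyOfActions, dif_pos hex]⟩

theorem strategyOfActions_ξ_of_τ_eq (h : (strategyOfActions u₀ a).τ p ω = (t : WithTop ℕ)) :
    (strategyOfActions u₀ a).ξ p ω = (a t ω).elim u₀ (↑) := by
  classical
  simp only [strategyOfActions] at h ⊢
  split_ifs at h with hex
  swap
  · exact absurd h.symm (WithTop.natCast_ne_top _)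
  have ht : Nat.find hex = t := by exact_mod_cast h
  rw [dif_pos hex, ht]

theorem strategyOfActions_ξ_of_τ_eq_top (h : (strategyOfActions u₀ a).τ p ω = ⊤) :
    (strategyOfActions u₀ a).ξ p ω = u₀ := by
  classical
  simp only [strategyOfActions] at h ⊢
  split_ifs at h with hex
  · exact absurd h (WithTop.natCast_ne_top _)
  · rw [dif_neg hex]

theorem strategyOfActions_ξ_mem (hu₀ : u₀ ∈ U) (p : ℕ) (ω : Ω) :
    (strategyOfActions u₀ a).ξ p ω ∈ U := by
  classical
  simp only [strategyOfActions]
  split_ifs with hex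
  · cases a (Nat.find hex) ω with
    | none => exact hu₀
    | some u => exact u.2
  · exact hu₀

/-- This holds at every `ω`, so the strategy built from optimal actions has exactly their expected
reward. -/
theorem actions_strategyOfActions (hu₀ : u₀ ∈ U) :
    (strategyOfActions u₀ a).actions U = a := by
  ext1 t
  ext1 ω
  cases h : a t ω with
  | none =>
    rw [Strategy.actions_eq_none_iff (strategyOfActions_ξ_mem hu₀)]
    intro p hp
    exact (strategyOfActions_τ_eq_iff.1 hp).2 h
  | some u =>
    rw [Strategy.actions_eq_some_iff (strategyOfActions_ξ_mem hu₀)]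
    have hp : (strategyOfActions u₀ a).τ (orderCount a t ω) ω = (t : WithTop ℕ) :=
      strategyOfActions_τ_eq_iff.2 ⟨rfl, by simp [h]⟩
    refine ⟨_, hp, ?_, fun q hq hc => hq.ne (strategyOfActions_τ_eq_iff.1 hc).1.symm⟩
    rw [strategyOfActions_ξ_of_τ_eq hp, h]
    rfl

theorem strategyOfActions_hasGaps {n : ℕ} (ha : ∀ t, a t ω ∈ allowed Δ n U (history a t ω)) :
    (strategyOfActions u₀ a).HasGaps Δ ω := by
  intro p
  rcases eq_or_ne ((strategyOfActions u₀ a).τ (p + 1) ω) ⊤ with hp | hp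
  · rw [hp]; exact le_top
  obtain ⟨t, ht⟩ : ∃ t : ℕ, (strategyOfActions u₀ a).τ (p + 1) ω = (t : WithTop ℕ) :=
    ⟨_, (WithTop.coe_untop _ hp).symm⟩
  obtain ⟨hc, hne⟩ := strategyOfActions_τ_eq_iff.1 ht
  obtain ⟨s, hst, hs⟩ := strategyOfActions_τ_lt (u₀ := u₀) (show p < orderCount a t ω by omega)
  rw [ht, hs]
  suffices s + Δ ≤ t by exact_mod_cast this
  have h1 := ((mem_allowed.1 (ha t)).resolve_left hne).1
  by_contra! hlt
  exact (strategyOfActions_τ_eq_iff.1 hs).2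
    (h1 _ (mem_take_history.2 ⟨s, hst, by omega, rfl⟩))

theorem strategyOfActions_τ_eq_top {n : ℕ}
    (ha : ∀ t, a t ω ∈ allowed Δ n U (history a t ω)) :
    (strategyOfActions u₀ a).τ n ω = ⊤ := by
  by_contra hp
  obtain ⟨t, ht⟩ : ∃ t : ℕ, (strategyOfActions u₀ a).τ n ω = (t : WithTop ℕ) :=
    ⟨_, (WithTop.coe_untop _ hp).symm⟩
  obtain ⟨hc, hne⟩ := strategyOfActions_τ_eq_iff.1 ht
  have := ((mem_allowed.1 (ha t)).resolve_left hne).2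
  exact absurd hc this.ne

end StrategyOfActions

/-! ### Adaptedness and admissibility under the recoding. -/

section Measurability

variable {Ω : Type*} {m : MeasurableSpace Ω} {P : Measure Ω} {ℱ : Filtration ℕ m} {d : ℕ} {Δ : ℕ}
  {U : Finset (EuclideanSpace ℝ (Fin d))}

theorem hasGaps_of_mem_admissible {δ : Strategy Ω d} (hδ : δ ∈ admissible P ℱ Δ U) :
    ∀ᵐ ω ∂P, δ.HasGaps Δ ω :=
  ae_all_iff.2 fun p => (hδ p).2.2

theorem adaptedActions_of_mem_admissible {δ : Strategy Ω d} (hδ : δ ∈ admissible P ℱ Δ U) :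
    AdaptedActions ℱ (δ.actions U) := by
  have hU : ∀ p ω, δ.ξ p ω ∈ U := fun p => (hδ p).2.1
  have hτ : ∀ p t, MeasurableSet[ℱ t] {ω | δ.τ p ω = (t : WithTop ℕ)} := fun p t => by
    obtain ⟨h, -⟩ := (hδ p).1
    exact h.measurableSet_eq t
  intro t x
  cases x with
  | none =>
    have : {ω | δ.actions U t ω = none} = ⋂ p, {ω | δ.τ p ω = (t : WithTop ℕ)}ᶜ := by
      ext ω
      simp [Strategy.actions_eq_none_iff hU]
    rw [this]
    exact MeasurableSet.iInter fun p => (hτ p t).compl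
  | some x =>
    have : {ω | δ.actions U t ω = some x} = ⋃ p,
        ((δ.ξ p ⁻¹' {(x : EuclideanSpace ℝ (Fin d))} ∩ {ω | δ.τ p ω = (t : WithTop ℕ)}) ∩
          ⋂ q, ⋂ _ : q < p, {ω | δ.τ q ω = (t : WithTop ℕ)}ᶜ) := by
      ext ω
      simp only [Set.mem_ofPred_eq, Strategy.actions_eq_some_iff hU, Set.mem_iUnion,
        Set.mem_inter_iff, Set.mem_preimage, Set.mem_singleton_iff, Set.mem_iInter,
        Set.mem_compl_iff]
      exact exists_congr fun p => by tauto
    rw [this]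
    refine MeasurableSet.iUnion fun p => MeasurableSet.inter ?_ ?_
    · obtain ⟨h, hξ⟩ := (hδ p).1
      -- On the event `τ_p = t`, the σ-algebras `ℱ_{τ_p}` and `ℱ_t` have the same trace.
      refine (h.measurableSet_inter_eq_iff _ t).1 (MeasurableSet.inter ?_ ?_)
      · exact hξ (measurableSet_singleton _)
      · exact h.measurableSet_eq' t
    · exact MeasurableSet.iInter fun q => MeasurableSet.iInter fun _ => (hτ q t).compl

theorem strategyOfActions_mem_admissibleAtMost {n : ℕ} {u₀ : EuclideanSpace ℝ (Fin d)}
    (hu₀ : u₀ ∈ U) {a : ℕ → Ω → Option {u // u ∈ U}} (had : AdaptedActions ℱ a)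
    (ha : ∀ t ω, a t ω ∈ allowed Δ n U (history a t ω)) :
    strategyOfActions u₀ a ∈ admissibleAtMost P ℱ Δ U n := by
  have hτ : ∀ p t, MeasurableSet[ℱ t]
      {ω | (strategyOfActions u₀ a).τ p ω = (t : WithTop ℕ)} := by
    intro p t
    have : {ω | (strategyOfActions u₀ a).τ p ω = (t : WithTop ℕ)} =
        (⋃ h : {h : List (Option {u // u ∈ U}) // h.countP Option.isSome = p},
          {ω | history a t ω = h}) ∩ {ω | a t ω = none}ᶜ := by
      ext ω
      simp [strategyOfActions_τ_eq_iff, orderCount]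
    rw [this]
    refine MeasurableSet.inter (MeasurableSet.iUnion fun h => ?_) (had t none).compl
    exact had.measurableSet_history t h.1
  refine ⟨fun p => ⟨⟨isStoppingTime_of_measurableSet_eq (hτ p), ?_⟩,
    strategyOfActions_ξ_mem hu₀ p, ae_of_all _ fun ω =>
      strategyOfActions_hasGaps (fun t => ha t ω) p⟩,
    ae_of_all _ fun ω => strategyOfActions_τ_eq_top fun t => ha t ω⟩
  intro B hB
  have hst : IsStoppingTime ℱ ((strategyOfActions u₀ a).τ p) :=
    isStoppingTime_of_measurableSet_eq (hτ p)
  -- Split according to the value of `τ_p`: where it is infinite, the impulse is the constant `u₀`.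
  have hdec : (strategyOfActions u₀ a).ξ p ⁻¹' B =
      (⋃ t : ℕ, (⋃ x : {x : Option {u // u ∈ U} // x.elim u₀ (↑) ∈ B}, {ω | a t ω = x}) ∩
        {ω | (strategyOfActions u₀ a).τ p ω = (t : WithTop ℕ)}) ∪
      ({_ω | u₀ ∈ B} ∩ (⋃ t : ℕ, {ω | (strategyOfActions u₀ a).τ p ω = (t : WithTop ℕ)})ᶜ) := by
    ext ω
    rcases eq_or_ne ((strategyOfActions u₀ a).τ p ω) ⊤ with hp | hp
    · have h1 : ∀ t : ℕ, (⊤ : WithTop ℕ) ≠ (t : WithTop ℕ) :=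
        fun t => (WithTop.natCast_ne_top t).symm
      simp [strategyOfActions_ξ_of_τ_eq_top hp, hp]
    · obtain ⟨t, ht⟩ : ∃ t : ℕ, (strategyOfActions u₀ a).τ p ω = (t : WithTop ℕ) :=
        ⟨_, (WithTop.coe_untop _ hp).symm⟩
      simp [strategyOfActions_ξ_of_τ_eq ht, ht]
  rw [hdec]
  refine MeasurableSet.union (MeasurableSet.iUnion fun t => ?_) (MeasurableSet.inter
    (MeasurableSet.const _) (MeasurableSet.iUnion fun t => hst.measurableSet_eq' t).compl)
  refine (hst.measurableSet_inter_eq_iff _ t).2 (MeasurableSet.inter ?_ (hτ p t))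
  exact MeasurableSet.iUnion fun x => had t x

end Measurability

/-! ### The cost of keeping only the first `n` impulses. -/

section Truncation

variable {Ω : Type*} {d : ℕ} {Δ : ℕ} {U : Finset (EuclideanSpace ℝ (Fin d))} {δ : Strategy Ω d}
  {ω : Ω} {θ : ℝ} {g Ψ : EuclideanSpace ℝ (Fin d) → ℝ} {X : ℕ → Ω → EuclideanSpace ℝ (Fin d)}

/-- The strategy that keeps the first `n` impulses only. -/
def Strategy.truncate (δ : Strategy Ω d) (n : ℕ) : Strategy Ω d where
  τ p ω := if p < n then δ.τ p ω else ⊤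
  ξ := δ.ξ

theorem Strategy.truncate_τ_of_lt {n p : ℕ} (h : p < n) (ω : Ω) :
    (δ.truncate n).τ p ω = δ.τ p ω := if_pos h

theorem Strategy.truncate_τ_of_le {n p : ℕ} (h : n ≤ p) (ω : Ω) :
    (δ.truncate n).τ p ω = ⊤ := if_neg (not_lt.2 h)

theorem Strategy.HasGaps.truncate (h : δ.HasGaps Δ ω) (n : ℕ) : (δ.truncate n).HasGaps Δ ω := by
  intro p
  rcases lt_or_ge (p + 1) n with hp | hp
  · rw [truncate_τ_of_lt hp, truncate_τ_of_lt (by omega)]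
    exact h p
  · rw [truncate_τ_of_le hp]
    exact le_top

theorem truncate_mem_admissibleAtMost {m : MeasurableSpace Ω} {P : Measure Ω}
    {ℱ : Filtration ℕ m} (hδ : δ ∈ admissible P ℱ Δ U) (n : ℕ) :
    δ.truncate n ∈ admissibleAtMost P ℱ Δ U n := by
  refine ⟨fun p => ⟨?_, (hδ p).2.1, ?_⟩, ae_of_all _ fun ω => Strategy.truncate_τ_of_le le_rfl ω⟩
  · obtain ⟨hτ, hξ⟩ := (hδ p).1
    -- Truncation only postpones decision times, so `ℱ_{τ_p}` grows and the unchanged impulse stays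
    -- measurable.
    have hle : δ.τ p ≤ (δ.truncate n).τ p := by
      intro ω
      rcases lt_or_ge p n with hp | hp
      · rw [Strategy.truncate_τ_of_lt hp]
      · rw [Strategy.truncate_τ_of_le hp]; exact le_top
    have hτ' : IsStoppingTime ℱ ((δ.truncate n).τ p) := by
      rcases lt_or_ge p n with hp | hp
      · have : (δ.truncate n).τ p = δ.τ p := funext (Strategy.truncate_τ_of_lt hp)
        rwa [this]
      · intro i
        have : {ω | (δ.truncate n).τ p ω ≤ WithTop.some i} = ∅ := by
          ext ω
          simp [Strategy.truncate_τ_of_le hp]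
        rw [this]
        exact @MeasurableSet.empty _ (ℱ i)
    exact ⟨hτ', hξ.mono (hτ.measurableSpace_mono hτ' hle) le_rfl⟩
  · filter_upwards [hasGaps_of_mem_admissible hδ] with ω hω using hω.truncate n p

theorem discount_nonneg (θ : ℝ) (t : WithTop ℕ) : 0 ≤ discount θ t := by
  cases t with
  | top => exact le_rfl
  | coe t => exact (Real.exp_pos _).le

theorem discount_le (hθ : 0 < θ) {k : ℕ} {t : WithTop ℕ} (h : (k : WithTop ℕ) ≤ t) :
    discount θ t ≤ Real.exp (-θ) ^ k := by
  rcases eq_or_ne t ⊤ with rfl | ht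
  · exact (pow_pos (Real.exp_pos _) _).le
  · obtain ⟨s, rfl⟩ : ∃ s : ℕ, t = (s : WithTop ℕ) := ⟨_, (WithTop.coe_untop _ ht).symm⟩
    have hks : k ≤ s := by exact_mod_cast h
    have : discount θ (s : WithTop ℕ) = Real.exp (-θ) ^ s := exp_neg_mul_nat θ s
    rw [this]
    exact pow_le_pow_of_le_one (Real.exp_pos _).le (Real.exp_le_one_iff.2 (by linarith)) hks

theorem abs_tsum_le_of_geometric_tail {f : ℕ → ℝ} {C q : ℝ} {N : ℕ} (hq0 : 0 ≤ q) (hq1 : q < 1)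
    (hf0 : ∀ k < N, f k = 0) (hf : ∀ k, |f k| ≤ C * q ^ k) :
    |∑' k, f k| ≤ C * q ^ N / (1 - q) := by
  have hgeo := summable_geometric_of_lt_one hq0 hq1
  have hs : Summable f := Summable.of_norm_bounded (hgeo.mul_left C) hf
  rw [← hs.sum_add_tsum_nat_add N,
    Finset.sum_eq_zero fun k hk => hf0 k (Finset.mem_range.1 hk), zero_add]
  have h1 : HasSum (fun k => C * q ^ N * q ^ k) (C * q ^ N / (1 - q)) :=
    (hasSum_geometric_of_lt_one hq0 hq1).mul_left _
  rw [← Real.norm_eq_abs]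
  refine tsum_of_norm_bounded h1 fun k => ?_
  refine (hf (k + N)).trans (le_of_eq ?_)
  rw [pow_add]; ring

theorem Strategy.HasGaps.discount_le (h : δ.HasGaps Δ ω) (hθ : 0 < θ) (l : ℕ) :
    discount θ (δ.τ l ω + (Δ : WithTop ℕ)) ≤ Real.exp (-θ * (Δ : ℝ)) ^ (l + 1) := by
  rw [exp_neg_mul_nat, ← pow_mul]
  refine ImpulseControl.discount_le hθ ?_
  have := add_le_add_left (h.mul_le l) (Δ : WithTop ℕ)
  refine le_trans (le_of_eq ?_) this
  norm_cast
  ring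

theorem Strategy.HasGaps.abs_discount_mul_le (h : δ.HasGaps Δ ω) (hθ : 0 < θ)
    (hU : ∀ p ω, δ.ξ p ω ∈ U) (l : ℕ) :
    |discount θ (δ.τ l ω + (Δ : WithTop ℕ)) * Ψ (δ.ξ l ω)| ≤
      (⨆ u : {u // u ∈ U}, |Ψ u|) * Real.exp (-θ * (Δ : ℝ)) * Real.exp (-θ * (Δ : ℝ)) ^ l := by
  rw [abs_mul, abs_of_nonneg (discount_nonneg _ _), mul_assoc, ← pow_succ', mul_comm]
  exact mul_le_mul (abs_actionCost_le (Ψ := Ψ) (some ⟨δ.ξ l ω, hU l ω⟩)) (h.discount_le hθ l)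
    (discount_nonneg _ _) (Real.iSup_nonneg fun _ => abs_nonneg _)

/-- Keeping the first `n` impulses only changes the payoff by at most `C₀ e^{-θΔn}`. -/
theorem Strategy.HasGaps.abs_totalPayoff_sub_truncate_le (h : δ.HasGaps Δ ω) (hΔ : 0 < Δ)
    (hθ : 0 < θ) (hU : ∀ p ω, δ.ξ p ω ∈ U) (hg_bdd : ∃ M : ℝ, ∀ x, |g x| ≤ M) (n : ℕ) :
    |totalPayoff Δ θ g Ψ X δ ω - totalPayoff Δ θ g Ψ X (δ.truncate n) ω| ≤
      tailConst Δ θ U g Ψ * Real.exp (-θ * (Δ : ℝ)) ^ n := by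
  have hΔ' : (0 : ℝ) < Δ := by exact_mod_cast hΔ
  have hq0 := (Real.exp_pos (-θ)).le
  have hq1 : Real.exp (-θ) < 1 := Real.exp_lt_one_iff.2 (by linarith)
  have hr0 := (Real.exp_pos (-θ * (Δ : ℝ))).le
  have hr1 : Real.exp (-θ * (Δ : ℝ)) < 1 := Real.exp_lt_one_iff.2 (by nlinarith)
  have h' := h.truncate n
  have hsg : ∀ δ : Strategy Ω d,
      Summable fun k : ℕ => Real.exp (-θ * (k : ℝ)) * g (controlled Δ X δ k ω) := fun δ =>
    Summable.of_norm_bounded ((summable_geometric_of_lt_one hq0 hq1).mul_left _)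
      fun k => abs_exp_mul_le hg_bdd k _
  have hsΨ : ∀ δ : Strategy Ω d, δ.HasGaps Δ ω → (∀ p ω, δ.ξ p ω ∈ U) →
      Summable fun l : ℕ => discount θ (δ.τ l ω + (Δ : WithTop ℕ)) * Ψ (δ.ξ l ω) :=
    fun δ h hU => Summable.of_norm_bounded ((summable_geometric_of_lt_one hr0 hr1).mul_left _)
      fun l => h.abs_discount_mul_le hθ hU l
  -- The first discarded impulse is ordered no earlier than `nΔ` and acts `Δ` later.
  have hctrl : ∀ k < (n + 1) * Δ, controlled Δ X δ k ω = controlled Δ X (δ.truncate n) k ω := by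
    intro k hk
    rw [h.controlled_eq hΔ, h'.controlled_eq hΔ]
    congr 1
    refine Finset.sum_congr rfl fun p _ => ?_
    rcases lt_or_ge p n with hp | hp
    · rw [truncate_τ_of_lt hp]; rfl
    · rw [truncate_τ_of_le hp, if_neg, if_neg]
      · simp
      · intro hc
        have h1 := (add_le_add_left ((h.mul_le n).trans (h.mono hp)) (Δ : WithTop ℕ)).trans hc
        have h2 : n * Δ + Δ ≤ k := by exact_mod_cast h1
        rw [add_mul, one_mul] at hk
        omega
  have b1 : |∑' k : ℕ, (Real.exp (-θ * (k : ℝ)) * g (controlled Δ X δ k ω) -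
      Real.exp (-θ * (k : ℝ)) * g (controlled Δ X (δ.truncate n) k ω))| ≤
      2 * (⨆ x, |g x|) * Real.exp (-θ) ^ ((n + 1) * Δ) / (1 - Real.exp (-θ)) := by
    refine abs_tsum_le_of_geometric_tail hq0 hq1 (fun k hk => ?_) fun k => ?_
    · rw [hctrl k hk, sub_self]
    · have h1 := abs_exp_mul_le (θ := θ) hg_bdd k (controlled Δ X δ k ω)
      have h2 := abs_exp_mul_le (θ := θ) hg_bdd k (controlled Δ X (δ.truncate n) k ω)
      have h3 := abs_sub (Real.exp (-θ * (k : ℝ)) * g (controlled Δ X δ k ω))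
        (Real.exp (-θ * (k : ℝ)) * g (controlled Δ X (δ.truncate n) k ω))
      linarith
  have b2 : |∑' l : ℕ, (discount θ (δ.τ l ω + (Δ : WithTop ℕ)) * Ψ (δ.ξ l ω) -
      discount θ ((δ.truncate n).τ l ω + (Δ : WithTop ℕ)) * Ψ ((δ.truncate n).ξ l ω))| ≤
      (⨆ u : {u // u ∈ U}, |Ψ u|) * Real.exp (-θ * (Δ : ℝ)) * Real.exp (-θ * (Δ : ℝ)) ^ n /
        (1 - Real.exp (-θ * (Δ : ℝ))) := by
    refine abs_tsum_le_of_geometric_tail hr0 hr1 (fun l hl => ?_) fun l => ?_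
    · rw [truncate_τ_of_lt hl]
      exact sub_self _
    · refine le_trans ?_ (h.abs_discount_mul_le hθ hU l)
      rcases lt_or_ge l n with hl | hl
      · rw [truncate_τ_of_lt hl]
        exact (abs_eq_zero.2 (sub_self _)).trans_le (abs_nonneg _)
      · rw [truncate_τ_of_le hl, top_add]
        simp [discount]
  rw [(hsg _).tsum_sub (hsg _)] at b1
  rw [(hsΨ _ h hU).tsum_sub (hsΨ _ h' hU)] at b2
  have hfin : tailConst Δ θ U g Ψ * Real.exp (-θ * (Δ : ℝ)) ^ n =
      2 * (⨆ x, |g x|) * Real.exp (-θ) ^ ((n + 1) * Δ) / (1 - Real.exp (-θ)) +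
      (⨆ u : {u // u ∈ U}, |Ψ u|) * Real.exp (-θ * (Δ : ℝ)) * Real.exp (-θ * (Δ : ℝ)) ^ n /
        (1 - Real.exp (-θ * (Δ : ℝ))) := by
    have : Real.exp (-θ) ^ ((n + 1) * Δ) =
        Real.exp (-θ * (Δ : ℝ)) * Real.exp (-θ * (Δ : ℝ)) ^ n := by
      rw [exp_neg_mul_nat, ← pow_mul, ← pow_add]
      congr 1
      ring
    rw [this, tailConst]
    ring
  rw [hfin, totalPayoff, totalPayoff]
  refine le_trans (le_of_eq ?_) ((abs_sub _ _).trans (add_le_add b1 b2))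
  congr 1
  ring

end Truncation

/-! ### Integrability, optimality with at most `n` impulses, and the choice of `n`. -/

section Optimality

variable {Ω : Type*} {m : MeasurableSpace Ω} {P : Measure Ω} [IsProbabilityMeasure P]
  {ℱ : Filtration ℕ m} {d : ℕ} {Δ : ℕ} {U : Finset (EuclideanSpace ℝ (Fin d))}
  {δ : Strategy Ω d} {θ : ℝ} {g Ψ : EuclideanSpace ℝ (Fin d) → ℝ}
  {X : ℕ → Ω → EuclideanSpace ℝ (Fin d)}

omit [IsProbabilityMeasure P] in
theorem totalPayoff_ae_eq (hδ : δ ∈ admissible P ℱ Δ U) (hΔ : 0 < Δ) (hθ : 0 < θ)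
    (hg_bdd : ∃ M : ℝ, ∀ x, |g x| ≤ M) :
    totalPayoff Δ θ g Ψ X δ =ᵐ[P]
      fun ω => ∑' t, reward Δ θ U g Ψ X (history (δ.actions U) (t + 1) ω) ω := by
  filter_upwards [hasGaps_of_mem_admissible hδ] with ω hω
  exact hω.totalPayoff_eq hΔ hθ (fun p => (hδ p).2.1) hg_bdd

theorem integrable_totalPayoff (hδ : δ ∈ admissible P ℱ Δ U) (hΔ : 0 < Δ) (hθ : 0 < θ)
    (hX : ∀ k, Measurable (X k)) (hg : Measurable g) (hg_bdd : ∃ M : ℝ, ∀ x, |g x| ≤ M) :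
    Integrable (totalPayoff Δ θ g Ψ X δ) P := by
  have hq0 := (Real.exp_pos (-θ)).le
  have hq1 : Real.exp (-θ) < 1 := Real.exp_lt_one_iff.2 (by linarith)
  have hbd : ∀ t ω, ‖reward Δ θ U g Ψ X (history (δ.actions U) (t + 1) ω) ω‖ ≤
      ((⨆ x, |g x|) + ⨆ u : {u // u ∈ U}, |Ψ u|) * Real.exp (-θ) ^ t := fun t ω => by
    have := abs_reward_cons_le (Δ := Δ) (Ψ := Ψ) (X := X) hθ hg_bdd (δ.actions U t ω)
      (history (δ.actions U) t ω) ω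
    rwa [length_history] at this
  have hsum := (hasSum_geometric_of_lt_one hq0 hq1).mul_left
    ((⨆ x, |g x|) + ⨆ u : {u // u ∈ U}, |Ψ u|)
  -- Measurability is checked on the sum of rewards of the recoded actions, which agrees almost
  -- surely with the payoff.
  refine Integrable.congr ?_ (totalPayoff_ae_eq (X := X) (Ψ := Ψ) hδ hΔ hθ hg_bdd).symm
  refine Integrable.of_bound (Measurable.aestronglyMeasurable ?_) _
    (ae_of_all _ fun ω => tsum_of_norm_bounded hsum fun t => hbd t ω)
  refine measurable_of_tendsto_metrizable (fun N => ?_) (tendsto_pi_nhds.2 fun ω =>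
    (Summable.of_norm_bounded hsum.summable fun t => hbd t ω).hasSum.tendsto_sum_nat)
  exact Finset.measurable_sum _ fun t _ => measurable_reward_history
    (fun h => measurable_reward hX hg h) (adaptedActions_of_mem_admissible hδ) (t + 1)

/-- There is an optimal strategy among those with at most `n` impulses. -/
theorem exists_optimal_strategy (hΔ : 0 < Δ) (hU : U.Nonempty) (hθ : 0 < θ)
    (hX : ∀ k, Measurable (X k)) (hg : Measurable g) (hg_bdd : ∃ M : ℝ, ∀ x, |g x| ≤ M) (n : ℕ) :
    ∃ δ' ∈ admissibleAtMost P ℱ Δ U n, ∀ δ ∈ admissibleAtMost P ℱ Δ U n,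
      J P Δ θ g Ψ X δ ≤ J P Δ θ g Ψ X δ' := by
  obtain ⟨u₀, hu₀⟩ := hU
  have hq1 : Real.exp (-θ) < 1 := Real.exp_lt_one_iff.2 (by linarith)
  obtain ⟨a, had, haS, hopt⟩ := exists_optimal_actions P ℱ (allowed_nonempty Δ n U)
    (Real.exp_pos (-θ)).le hq1 (fun h => measurable_reward (Δ := Δ) (θ := θ) (Ψ := Ψ) hX hg h)
    (abs_reward_cons_le hθ hg_bdd)
  have hmem : strategyOfActions u₀ a ∈ admissibleAtMost P ℱ Δ U n :=
    strategyOfActions_mem_admissibleAtMost hu₀ had fun t ω => haS t ω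
  refine ⟨_, hmem, fun δ hδ => ?_⟩
  rw [J, J, integral_congr_ae (totalPayoff_ae_eq hδ.1 hΔ hθ hg_bdd),
    integral_congr_ae (totalPayoff_ae_eq hmem.1 hΔ hθ hg_bdd), actions_strategyOfActions hu₀]
  refine hopt _ (adaptedActions_of_mem_admissible hδ.1) fun t => ?_
  filter_upwards [hasGaps_of_mem_admissible hδ.1, hδ.2] with ω h1 h2
  exact h1.actions_mem_allowed hΔ (fun p => (hδ.1 p).2.1) h2 t

theorem J_le_J_truncate_add (hδ : δ ∈ admissible P ℱ Δ U) (hΔ : 0 < Δ) (hθ : 0 < θ)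
    (hX : ∀ k, Measurable (X k)) (hg : Measurable g) (hg_bdd : ∃ M : ℝ, ∀ x, |g x| ≤ M) (n : ℕ) :
    J P Δ θ g Ψ X δ ≤
      J P Δ θ g Ψ X (δ.truncate n) + tailConst Δ θ U g Ψ * Real.exp (-θ * (Δ : ℝ)) ^ n := by
  have i1 := integrable_totalPayoff (Ψ := Ψ) hδ hΔ hθ hX hg hg_bdd
  have i2 := integrable_totalPayoff (Ψ := Ψ) (truncate_mem_admissibleAtMost hδ n).1 hΔ hθ hX hg
    hg_bdd
  have h1 : J P Δ θ g Ψ X δ ≤ ∫ ω, (totalPayoff Δ θ g Ψ X (δ.truncate n) ω +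
      tailConst Δ θ U g Ψ * Real.exp (-θ * (Δ : ℝ)) ^ n) ∂P := by
    refine integral_mono_ae i1 (i2.add (integrable_const _)) ?_
    filter_upwards [hasGaps_of_mem_admissible hδ] with ω hω
    have := (abs_le.1 (hω.abs_totalPayoff_sub_truncate_le (Ψ := Ψ) (X := X) hΔ hθ
      (fun p => (hδ p).2.1) hg_bdd n)).2
    linarith
  rwa [integral_add i2 (integrable_const _), integral_const, probReal_univ, one_smul] at h1

theorem mul_exp_pow_le_of_floor_lt {C ε : ℝ} (hC : 0 ≤ C) (hε : 0 < ε) (hθ : 0 < θ) (hΔ : 0 < Δ)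
    {n : ℕ} (hn : ⌊1 / (θ * (Δ : ℝ)) * Real.log (C / ε)⌋ + 1 ≤ (n : ℤ)) :
    C * Real.exp (-θ * (Δ : ℝ)) ^ n ≤ ε := by
  -- For `C = 0` the convention `Real.log 0 = 0` makes the threshold `1`, so every `n ≥ 1` is
  -- allowed, as intended.
  rcases hC.eq_or_lt with rfl | hC
  · simpa using hε.le
  have hΔ' : (0 : ℝ) < θ * Δ := mul_pos hθ (by exact_mod_cast hΔ)
  have h1 : 1 / (θ * (Δ : ℝ)) * Real.log (C / ε) < n := by
    refine (Int.lt_floor_add_one _).trans_le ?_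
    exact_mod_cast hn
  have h2 : Real.log (C / ε) ≤ n * (θ * Δ) := by
    rw [one_div, inv_mul_lt_iff₀ hΔ'] at h1
    linarith
  have h3 : C / ε ≤ Real.exp (n * (θ * Δ)) :=
    (Real.log_le_iff_le_exp (div_pos hC hε)).1 h2
  rw [← Real.exp_nat_mul, show (n : ℝ) * (-θ * Δ) = -(n * (θ * Δ)) by ring, Real.exp_neg,
    ← div_eq_mul_inv, div_le_iff₀ (Real.exp_pos _)]
  rwa [div_le_iff₀' hε] at h3

theorem tailConst_nonneg (hθ : 0 < θ) (hΔ : 0 < Δ) : 0 ≤ tailConst Δ θ U g Ψ := by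
  have hΔ' : (0 : ℝ) < Δ := by exact_mod_cast hΔ
  have hq1 : Real.exp (-θ) < 1 := Real.exp_lt_one_iff.2 (by linarith)
  have hr1 : Real.exp (-θ * (Δ : ℝ)) < 1 := Real.exp_lt_one_iff.2 (by nlinarith)
  refine mul_nonneg (Real.exp_pos _).le (add_nonneg (div_nonneg (mul_nonneg zero_le_two
    (Real.iSup_nonneg fun _ => abs_nonneg _)) (by linarith)) (div_nonneg
    (Real.iSup_nonneg fun _ => abs_nonneg _) (by linarith)))

end Optimality

end ImpulseControl

theorem mainTheorem2 {Ω : Type*} {m : MeasurableSpace Ω} (P : Measure Ω) [IsProbabilityMeasure P]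
    (ℱ : Filtration ℕ m) {d : ℕ} (Δ : ℕ) (hΔ : 0 < Δ)
    (U : Finset (EuclideanSpace ℝ (Fin d))) (hU : U.Nonempty)
    (X : ℕ → Ω → EuclideanSpace ℝ (Fin d)) (hX : Adapted ℱ X)
    (θ : ℝ) (hθ : 0 < θ)
    (g Ψ : EuclideanSpace ℝ (Fin d) → ℝ)
    (hg : Measurable g) (hg_bdd : ∃ M : ℝ, ∀ x, |g x| ≤ M) :
    (∀ δ ∈ ImpulseControl.admissible P ℱ Δ U,
      Integrable (ImpulseControl.totalPayoff Δ θ g Ψ X δ) P) ∧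
    ∀ ε : ℝ, 0 < ε →
      (∃ n : ℕ, 1 ≤ n ∧ ∃ δε ∈ ImpulseControl.admissibleAtMost P ℱ Δ U n,
        (⨆ δ ∈ ImpulseControl.admissible P ℱ Δ U,
            (ImpulseControl.J P Δ θ g Ψ X δ : EReal))
          ≤ ((ImpulseControl.J P Δ θ g Ψ X δε + ε : ℝ) : EReal)) ∧
      (∀ n : ℕ, 1 ≤ n →
        ⌊1 / (θ * (Δ : ℝ)) * Real.log (ImpulseControl.tailConst Δ θ U g Ψ / ε)⌋ + 1 ≤ (n : ℤ) →
        ∃ δε ∈ ImpulseControl.admissibleAtMost P ℱ Δ U n,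
          (ImpulseControl.J P Δ θ g Ψ X δε : EReal) =
            (⨆ δ ∈ ImpulseControl.admissibleAtMost P ℱ Δ U n,
              (ImpulseControl.J P Δ θ g Ψ X δ : EReal)) ∧
          (⨆ δ ∈ ImpulseControl.admissible P ℱ Δ U,
              (ImpulseControl.J P Δ θ g Ψ X δ : EReal))
            ≤ ((ImpulseControl.J P Δ θ g Ψ X δε + ε : ℝ) : EReal)) := by

  have hX' : ∀ k, Measurable (X k) := fun k => (hX k).mono (ℱ.le k) le_rfl
  refine ⟨fun δ hδ => ImpulseControl.integrable_totalPayoff hδ hΔ hθ hX' hg hg_bdd,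
    fun ε hε => ?_⟩
  have main : ∀ n : ℕ, 1 ≤ n →
      ⌊1 / (θ * (Δ : ℝ)) * Real.log (ImpulseControl.tailConst Δ θ U g Ψ / ε)⌋ + 1 ≤ (n : ℤ) →
      ∃ δε ∈ ImpulseControl.admissibleAtMost P ℱ Δ U n,
        (ImpulseControl.J P Δ θ g Ψ X δε : EReal) =
          (⨆ δ ∈ ImpulseControl.admissibleAtMost P ℱ Δ U n,
            (ImpulseControl.J P Δ θ g Ψ X δ : EReal)) ∧
        (⨆ δ ∈ ImpulseControl.admissible P ℱ Δ U,
            (ImpulseControl.J P Δ θ g Ψ X δ : EReal))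
          ≤ ((ImpulseControl.J P Δ θ g Ψ X δε + ε : ℝ) : EReal) := by
    intro n _ hn
    obtain ⟨δ', hδ', hopt⟩ := ImpulseControl.exists_optimal_strategy (P := P) (ℱ := ℱ) (Ψ := Ψ)
      hΔ hU hθ hX' hg hg_bdd n
    -- Suprema in `EReal` are genuine least upper bounds, so no separate boundedness of `J` is
    -- needed.
    refine ⟨δ', hδ', le_antisymm
      (le_iSup₂ (f := fun δ (_ : δ ∈ ImpulseControl.admissibleAtMost P ℱ Δ U n) =>
        (ImpulseControl.J P Δ θ g Ψ X δ : EReal)) δ' hδ')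
      (iSup₂_le fun δ hδ => EReal.coe_le_coe_iff.2 (hopt δ hδ)),
      iSup₂_le fun δ hδ => EReal.coe_le_coe_iff.2 ?_⟩
    have h1 := ImpulseControl.J_le_J_truncate_add (Ψ := Ψ) hδ hΔ hθ hX' hg hg_bdd n
    have h2 := hopt _ (ImpulseControl.truncate_mem_admissibleAtMost hδ n)
    have h3 := ImpulseControl.mul_exp_pow_le_of_floor_lt
      (ImpulseControl.tailConst_nonneg (U := U) (g := g) (Ψ := Ψ) hθ hΔ) hε hθ hΔ hn
    linarith
  refine ⟨?_, main⟩
  -- The integer threshold may be nonpositive when `ε` is large, hence `toNat` and the maximum with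
  -- `1`.
  let n : ℕ :=
    max 1 (⌊1 / (θ * (Δ : ℝ)) * Real.log (ImpulseControl.tailConst Δ θ U g Ψ / ε)⌋ + 1).toNat
  obtain ⟨δε, h1, -, h2⟩ := main n (le_max_left _ _)
    ((Int.self_le_toNat _).trans (by exact_mod_cast le_max_right _ _))
  exact ⟨n, le_max_left _ _, δε, h1, h2⟩
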